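/- **Theorem (error bounds for HBROT$\omega$ and HBROTP$\omega$).** Let $k,\omega\ge 1$ and $m<n$ be integers with $n>3k$, let $A\in\mathbb R^{m\times n}$, $x\in\mathbb R^n$, $\nu\in\mathbb R^m$ and $y=Ax+\nu$. For $z\in\mathbb R^n$ and an index set $\Omega$, $z_\Omega$ denotes $z$ with the entries outside $\Omega$ set to zero. $\mathcal L_k(z)$ is an index set of $k$ largest absolute entries of $z$ (any choice in case of ties), $\mathcal H_k(z)=z_{\mathcal L_k(z)}$, and $\otimes$ is the entrywise product. Let $S=\mathcal L_k(x)$ and $\nu'=\nu+Ax_{\overline S}$. The restricted isometry constant $\delta_j$ of $A$ is the smallest $\delta\ge 0$ with $(1-\delta)\|u\|_2^2\le\|Au\|_2^2\le(1+\delta)\|u\|_2^2$ for all $j$-sparse $u\in\mathbb R^n$. Let $\mathcal P^k=\{w\in\mathbb R^n:\sum_i w_i=k,\ 0\le w_i\le 1\}$. *Algorithms.* Given $\alpha,\beta$ and starting points $x^0,x^1\in\mathbb R^n$, where $x^1$ is $k$-sparse, for $p\ge1$ put $u^p=x^p-\alpha A^T(Ax^p-y)+\beta(x^p-x^{p-1})$,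 and for $j=1,\dots,\omega$ let $w^{(j)}$ be any minimizer of $\|y-A(u^p\otimes w^{(1)}\otimes\cdots\otimes w^{(j-1)}\otimes w)\|_2^2$ over $w\in\mathcal P^k$. Let $x^\sharp=\mathcal H_k(u^p\otimes w^{(1)}\otimes\cdots\otimes w^{(\omega)})$. HBROT$\omega$ sets $x^{p+1}=x^\sharp$; HBROTP$\omega$ takes for $x^{p+1}$ a minimizer of $\|y-Az\|_2^2$ over all $z$ with $\mathrm{supp}(z)\subseteq\mathrm{supp}(x^\sharp)$. *Constants.* Let $\sigma=\lceil (n-2k)/k\rceil$; $\xi_1=1$, $\xi_q=\frac{2}{\sqrt q}+\frac{\sqrt q}{4}$ for $2\le q<8$, $\xi_q=\sqrt2$ for $q\ge8$; $t_k=\frac{\sqrt{1+\delta_k}}{\sqrt{1-\delta_{2k}}}$, $z_k=\sqrt{1-\delta_{2k}^2}$; $$d_0=t_k(\omega\xi_\sigma+1),\quad d_1=t_k(2\omega\delta_{3k}+\delta_{2k})+\delta_{3k},\quad d_2=t_k[\xi_\sigma(\omega-1)+1]\frac{2\omega\delta_{3k}+\delta_{2k}}{2(\omega-1)\delta_{3k}+\delta_{2k}};$$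 $$c_{1,\sigma}=(\xi_\sigma(\omega-1)+1)|1-\alpha+\beta|+\alpha(2(\omega-1)\delta_{3k}+\delta_{2k}),\quad c_\sigma=(\omega\xi_\sigma+1)|1-\alpha+\beta|+\alpha(2\omega\delta_{3k}+\delta_{2k});$$ $$b_1=t_kc_\sigma+|1+\beta-\alpha|+\alpha\delta_{3k},\qquad b_2=\beta t_k[\xi_\sigma(\omega-1)+1]\frac{c_\sigma}{c_{1,\sigma}}+\beta,$$ $$b_3=\frac{\alpha(2\omega-1)(1+\delta_k)+2}{\sqrt{1-\delta_{2k}}}\cdot\frac{2\delta_{3k}}{2(\omega-1)\delta_{3k}+\delta_{2k}}\cdot\frac{c_\sigma}{c_\sigma-c_{1,\sigma}}+\alpha\sqrt{1+\delta_k};$$ $$\theta_1=\frac{b_1+\sqrt{b_1^2+4b_2}}{2},\qquad \theta_2=\frac{b_1+\sqrt{b_1^2+4b_2z_k}}{2z_k}.$$ Let $G_\omega(\gamma)=(2\omega+1)\gamma\sqrt{\frac{1+\gamma}{1-\gamma}}+\gamma$. Then each of the equations $G_\omega(\gamma)=1$ and $\frac{1}{\sqrt{1-\gamma^2}}G_\omega(\gamma)=1$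 has a unique root in $(0,1)$, denoted by $\gamma^*(\omega)$ and $\gamma^\sharp(\omega)$ respectively, and the following hold. (i) If $\delta_{3k}<\gamma^*(\omega)$ and $$0\le\beta<\frac{1-d_1}{1+d_1+d_2},\qquad \frac{(d_0+d_2+2)\beta+d_0}{d_0-d_1+1}<\alpha<\frac{d_0+2-(d_2-d_0)\beta}{d_0+d_1+1},$$ then $\theta_1<1$ and every sequence $\{x^p\}$ produced by HBROT$\omega$ satisfies, for all $p\ge1$, $$\|x^p-x_S\|_2\le\theta_1^{p-1}\big[\|x^1-x_S\|_2+(\theta_1-b_1)\|x^0-x_S\|_2\big]+\frac{b_3}{1-\theta_1}\|\nu'\|_2.$$ (ii) If $\delta_{3k}<\gamma^\sharp(\omega)$ and $$0\le\beta<\frac{z_k-d_1}{1+d_1+d_2},\qquad \frac{(d_0+d_2+2)\beta+d_0+1-z_k}{d_0-d_1+1}<\alpha<\frac{d_0+1+z_k-(d_2-d_0)\beta}{d_0+d_1+1},$$ then $\theta_2<1$ and every sequence $\{x^p\}$ produced by HBROTP$\omega$ satisfies, for all $p\ge1$, $$\|x^p-x_S\|_2\le\theta_2^{p-1}\Big[\|x^1-x_S\|_2+\Big(\theta_2-\frac{b_1}{z_k}\Big)\|x^0-x_S\|_2\Big]+\frac{1}{1-\theta_2}\Big(\frac{b_3}{z_k}+\frac{\sqrt{1+\delta_k}}{1-\delta_{2k}}\Big)\|\nu'\|_2.$$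 -/

import Mathlib

open scoped Matrix

noncomputable section

namespace HeavyBall

/-- `ℝⁿ` with the Euclidean norm. -/
abbrev Vec (n : ℕ) : Type := EuclideanSpace ℝ (Fin n)

/-- The matrix-vector product `A x`, as a map between Euclidean spaces. -/
def app {m n : ℕ} (A : Matrix (Fin m) (Fin n) ℝ) (x : Vec n) : Vec m :=
  WithLp.toLp 2 (A *ᵥ x.ofLp)

/-- The Hadamard (entrywise) product `v ⊗ w`. -/
def hadamard {n : ℕ} (v w : Vec n) : Vec n :=
  WithLp.toLp 2 (fun i => v i * w i)

/-- The support of a vector. -/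
def supp {n : ℕ} (z : Vec n) : Finset (Fin n) :=
  Finset.univ.filter (fun i => z i ≠ 0)

/-- `z` is `k`-sparse: it has at most `k` nonzero entries. -/
def IsSparse {n : ℕ} (k : ℕ) (z : Vec n) : Prop :=
  (supp z).card ≤ k

/-- `z_Ω`: keep the entries of `z` indexed by `Ω` and set the others to zero. -/
def restrict {n : ℕ} (z : Vec n) (Ω : Finset (Fin n)) : Vec n :=
  WithLp.toLp 2 (fun i => if i ∈ Ω then z i else 0)

/-- `L` is an index set of `k` largest absolute entries of `z` (ties broken arbitrarily). -/
def IsLargest {n : ℕ} (k : ℕ) (z : Vec n) (L : Finset (Fin n)) : Prop :=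
  L.card = k ∧ ∀ i ∈ L, ∀ j ∉ L, |z j| ≤ |z i|

/-- `h` is a hard thresholding `H_k(z)` of `z`. -/
def IsHardThresholding {n : ℕ} (k : ℕ) (z h : Vec n) : Prop :=
  ∃ L : Finset (Fin n), IsLargest k z L ∧ h = restrict z L

/-- The numbers `δ ≥ 0` with `(1 - δ) ‖u‖² ≤ ‖A u‖² ≤ (1 + δ) ‖u‖²` for all `k`-sparse `u`. -/
def ricSet {m n : ℕ} (A : Matrix (Fin m) (Fin n) ℝ) (k : ℕ) : Set ℝ :=
  {δ : ℝ | 0 ≤ δ ∧ ∀ u : Vec n, IsSparse k u →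
    (1 - δ) * ‖u‖ ^ 2 ≤ ‖app A u‖ ^ 2 ∧ ‖app A u‖ ^ 2 ≤ (1 + δ) * ‖u‖ ^ 2}

/-- The restricted isometry constant `δ_k` of `A`: the least element of `ricSet A k`. -/
def ric {m n : ℕ} (A : Matrix (Fin m) (Fin n) ℝ) (k : ℕ) : ℝ :=
  sInf (ricSet A k)

/-- The infimum that defines the restricted isometry constant is attained. -/
theorem isLeast_ric {m n : ℕ} (A : Matrix (Fin m) (Fin n) ℝ) (k : ℕ) :
    IsLeast (ricSet A k) (ric A k) := by
  have hbdd : BddBelow (ricSet A k) := ⟨0, fun δ hδ => hδ.1⟩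
  have hne : (ricSet A k).Nonempty := by
    have hC := (Matrix.toEuclideanLin A).toContinuousLinearMap.le_opNorm
    set C := ‖(Matrix.toEuclideanLin A).toContinuousLinearMap‖ with hCdef
    have hC0 : 0 ≤ C := norm_nonneg _
    refine ⟨1 + C ^ 2, by positivity, fun u _ => ⟨?_, ?_⟩⟩
    · nlinarith [sq_nonneg ‖app A u‖, mul_nonneg (sq_nonneg C) (sq_nonneg ‖u‖)]
    · have h1 : ‖app A u‖ ≤ C * ‖u‖ := hC u
      have h2 : ‖app A u‖ ^ 2 ≤ (C * ‖u‖) ^ 2 := by gcongr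
      nlinarith [sq_nonneg ‖u‖]
  have hcl : IsClosed (ricSet A k) := by
    have : ricSet A k = Set.Ici 0 ∩ ⋂ (u : Vec n) (_ : IsSparse k u),
        ({δ : ℝ | (1 - δ) * ‖u‖ ^ 2 ≤ ‖app A u‖ ^ 2} ∩
          {δ : ℝ | ‖app A u‖ ^ 2 ≤ (1 + δ) * ‖u‖ ^ 2}) := by
      ext δ
      simp [ricSet]
    rw [this]
    refine isClosed_Ici.inter (isClosed_biInter fun u _ => IsClosed.inter ?_ ?_)
    · exact isClosed_le (by fun_prop) (by fun_prop)
    · exact isClosed_le (by fun_prop) (by fun_prop)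
  exact ⟨hcl.csInf_mem hne hbdd, fun δ hδ => csInf_le hbdd hδ⟩

/-! ### The algorithms -/

/-- The polytope `P^k = {w : eᵀ w = k, 0 ≤ w ≤ e}`. -/
def polytope (n k : ℕ) : Set (Vec n) :=
  {w | ∑ i, w i = (k : ℝ) ∧ ∀ i, 0 ≤ w i ∧ w i ≤ 1}

/-- The heavy-ball point `u^p = x^p - α Aᵀ (A x^p - y) + β (x^p - x^{p-1})`. -/
def heavyBall {m n : ℕ} (A : Matrix (Fin m) (Fin n) ℝ) (y : Vec m) (α β : ℝ)
    (xprev xcur : Vec n) : Vec n :=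
  xcur - α • app Aᵀ (app A xcur - y) + β • (xcur - xprev)

/-- The vector `u ⊗ w⁽¹⁾ ⊗ ⋯ ⊗ w⁽ʲ⁾`. -/
def compressed {n : ℕ} (u : Vec n) (w : ℕ → Vec n) : ℕ → Vec n
  | 0 => u
  | j + 1 => hadamard (compressed u w j) (w (j + 1))

/-- `w⁽¹⁾, …, w⁽ω⁾` arise from `u` by `ω` successive data compressions: `w⁽ʲ⁺¹⁾` is a minimizer of
`‖y - A (v ⊗ w)‖²` over `w ∈ P^k`, where `v = u ⊗ w⁽¹⁾ ⊗ ⋯ ⊗ w⁽ʲ⁾`. -/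
def IsCompression {m n : ℕ} (A : Matrix (Fin m) (Fin n) ℝ) (y : Vec m) (k ω : ℕ)
    (u : Vec n) (w : ℕ → Vec n) : Prop :=
  ∀ j < ω, w (j + 1) ∈ polytope n k ∧
    IsMinOn (fun v => ‖y - app A (hadamard (compressed u w j) v)‖ ^ 2) (polytope n k) (w (j + 1))

/-- `xs` is a possible vector `x^♯ = H_k(u^p ⊗ w⁽¹⁾ ⊗ ⋯ ⊗ w⁽ω⁾)` for the iterates `x^{p-1}, x^p`. -/
def IsSharp {m n : ℕ} (A : Matrix (Fin m) (Fin n) ℝ) (y : Vec m) (k ω : ℕ) (α β : ℝ)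
    (xprev xcur xs : Vec n) : Prop :=
  ∃ w : ℕ → Vec n, IsCompression A y k ω (heavyBall A y α β xprev xcur) w ∧
    IsHardThresholding k (compressed (heavyBall A y α β xprev xcur) w ω) xs

/-- `z` solves the least squares problem `min {‖y - A x‖² : supp x ⊆ T}`. -/
def IsLeastSquares {m n : ℕ} (A : Matrix (Fin m) (Fin n) ℝ) (y : Vec m)
    (T : Finset (Fin n)) (z : Vec n) : Prop :=
  supp z ⊆ T ∧ IsMinOn (fun x => ‖y - app A x‖ ^ 2) {x | supp x ⊆ T} z

/-- `x⁰, x¹, x², …` is a sequence produced by `HBROTω`. -/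
def IsHBROT {m n : ℕ} (A : Matrix (Fin m) (Fin n) ℝ) (y : Vec m) (k ω : ℕ) (α β : ℝ)
    (x : ℕ → Vec n) : Prop :=
  ∀ p : ℕ, IsSharp A y k ω α β (x p) (x (p + 1)) (x (p + 2))

/-- `x⁰, x¹, x², …` is a sequence produced by `HBROTPω`. -/
def IsHBROTP {m n : ℕ} (A : Matrix (Fin m) (Fin n) ℝ) (y : Vec m) (k ω : ℕ) (α β : ℝ)
    (x : ℕ → Vec n) : Prop :=
  ∀ p : ℕ, ∃ xs : Vec n, IsSharp A y k ω α β (x p) (x (p + 1)) xs ∧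
    IsLeastSquares A y (supp xs) (x (p + 2))

/-! ### The constants -/

/-- `ξ_q` for `q ≥ 1`. -/
def xi (q : ℕ) : ℝ :=
  if q = 1 then 1 else if q < 8 then 2 / √(q : ℝ) + √(q : ℝ) / 4 else √2

/-- `σ = ⌈(n - 2k) / k⌉`. -/
def sigma (n k : ℕ) : ℕ := ⌈((n : ℝ) - 2 * k) / k⌉₊

/-- `G_ω(γ) = (2ω + 1) γ √((1 + γ) / (1 - γ)) + γ`. -/
def G (ω : ℕ) (γ : ℝ) : ℝ := (2 * ω + 1) * γ * √((1 + γ) / (1 - γ)) + γ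

/-- `γ` is a root in `(0, 1)` of `G_ω(γ) = 1`. -/
def IsGammaStar (ω : ℕ) (γ : ℝ) : Prop := γ ∈ Set.Ioo (0 : ℝ) 1 ∧ G ω γ = 1

/-- `γ` is a root in `(0, 1)` of `G_ω(γ) / √(1 - γ²) = 1`. -/
def IsGammaSharp (ω : ℕ) (γ : ℝ) : Prop :=
  γ ∈ Set.Ioo (0 : ℝ) 1 ∧ 1 / √(1 - γ ^ 2) * G ω γ = 1

section Constants

variable {m n : ℕ} (A : Matrix (Fin m) (Fin n) ℝ) (k ω : ℕ) (α β : ℝ)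

def t : ℝ := √(1 + ric A k) / √(1 - ric A (2 * k))

def z : ℝ := √(1 - ric A (2 * k) ^ 2)

def d0 : ℝ := t A k * (ω * xi (sigma n k) + 1)

def d1 : ℝ := t A k * (2 * ω * ric A (3 * k) + ric A (2 * k)) + ric A (3 * k)

def d2 : ℝ :=
  t A k * (xi (sigma n k) * ((ω : ℝ) - 1) + 1) *
    ((2 * ω * ric A (3 * k) + ric A (2 * k)) / (2 * ((ω : ℝ) - 1) * ric A (3 * k) + ric A (2 * k)))

/-- `c_{1,σ}` -/
def c1 : ℝ :=
  (xi (sigma n k) * ((ω : ℝ) - 1) + 1) * |1 - α + β| +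
    α * (2 * ((ω : ℝ) - 1) * ric A (3 * k) + ric A (2 * k))

/-- `c_σ` -/
def c : ℝ :=
  (ω * xi (sigma n k) + 1) * |1 - α + β| + α * (2 * ω * ric A (3 * k) + ric A (2 * k))

def b1 : ℝ := t A k * c A k ω α β + (|1 + β - α| + α * ric A (3 * k))

def b2 : ℝ :=
  β * t A k * (xi (sigma n k) * ((ω : ℝ) - 1) + 1) * (c A k ω α β / c1 A k ω α β) + β

def b3 : ℝ :=
  (α * (2 * ω - 1) * (1 + ric A k) + 2) / √(1 - ric A (2 * k)) *
    (2 * ric A (3 * k) / (2 * ((ω : ℝ) - 1) * ric A (3 * k) + ric A (2 * k))) *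
    (c A k ω α β / (c A k ω α β - c1 A k ω α β)) + α * √(1 + ric A k)

def theta1 : ℝ := (b1 A k ω α β + √(b1 A k ω α β ^ 2 + 4 * b2 A k ω α β)) / 2

def theta2 : ℝ :=
  (b1 A k ω α β + √(b1 A k ω α β ^ 2 + 4 * b2 A k ω α β * z A k)) / (2 * z A k)

/-- The parameter range of `(α, β)` for `HBROTω`. -/
def RangeHBROT : Prop :=
  (0 ≤ β ∧ β < (1 - d1 A k ω) / (1 + d1 A k ω + d2 A k ω)) ∧
  ((d0 A k ω + d2 A k ω + 2) * β + d0 A k ω) / (d0 A k ω - d1 A k ω + 1) < α ∧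
  α < (d0 A k ω + 2 - (d2 A k ω - d0 A k ω) * β) / (d0 A k ω + d1 A k ω + 1)

/-- The parameter range of `(α, β)` for `HBROTPω`. -/
def RangeHBROTP : Prop :=
  (0 ≤ β ∧ β < (z A k - d1 A k ω) / (1 + d1 A k ω + d2 A k ω)) ∧
  ((d0 A k ω + d2 A k ω + 2) * β + d0 A k ω + 1 - z A k) / (d0 A k ω - d1 A k ω + 1) < α ∧
  α < (d0 A k ω + 1 + z A k - (d2 A k ω - d0 A k ω) * β) / (d0 A k ω + d1 A k ω + 1)

end Constants

end HeavyBall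

end

/-! Write `s = x_S`, so that `y = A s + ν'`, and measure all errors against `s`. The heavy-ball
point satisfies `u - s = (1-α+β)(x-s) + α(I - AᵀA)(x-s) - β(x'-s) + αAᵀν'`. On any index set of size
at most `k`, the restricted isometry property makes the second term at most `αδ_{3k}‖x-s‖` and the
last at most `α√(1+δ_k)‖ν'‖`.

The compressions are controlled by two facts. The indicator of `S` lies in `P^k`, so each
compression leaves a residual no larger than that of the previous vector restricted to `S`. Off `S`,
the weights lie in `[0,1]` and sum to at most `k`: cut into blocks of size `k` by decreasing weight,
their block bounds `a_b` sum to at most `2`, and Cauchy–Schwarz gives `∑ a_b ‖(x-s)_b‖ ≤ √2 ‖x-s‖`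
(`norm_app_restrict_compressed_le`). Each compression thus adds one such tail to the residual. Hard
thresholding and the lower isometry bound turn the residual into the one-step error
(`norm_sharp_sub_le`).

This gives constants with `√2` in place of `ξ_σ`. Since `n > 3k` forces `σ ≥ 2`, `√2 ≤ ξ_σ ≤ 2`, and
`sharp_bound_le` passes to `b₁, b₂, b₃`. For HBROTPω the least-squares step costs a factor `1/z_k`
and one more noise term (`norm_leastSquares_sub_le`). The parameter ranges say that an upper bound
for `b₁ + b₂` is below `1`, respectively `z_k`, so the second-order recursion contracts at the rate
of its characteristic root (`recursion_bound`). -/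

namespace HeavyBall

variable {m n : ℕ}

/-! ### Linear algebra of `app` and `restrict` -/

theorem app_add (A : Matrix (Fin m) (Fin n) ℝ) (u v : Vec n) :
    app A (u + v) = app A u + app A v :=
  map_add (Matrix.toEuclideanLin A) u v

theorem app_sub (A : Matrix (Fin m) (Fin n) ℝ) (u v : Vec n) :
    app A (u - v) = app A u - app A v :=
  map_sub (Matrix.toEuclideanLin A) u v

theorem app_smul (A : Matrix (Fin m) (Fin n) ℝ) (r : ℝ) (u : Vec n) :
    app A (r • u) = r • app A u :=
  map_smul (Matrix.toEuclideanLin A) r u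

theorem app_sum {ι : Type*} (A : Matrix (Fin m) (Fin n) ℝ) (s : Finset ι) (u : ι → Vec n) :
    app A (∑ i ∈ s, u i) = ∑ i ∈ s, app A (u i) :=
  map_sum (Matrix.toEuclideanLin A) u s

theorem inner_app_transpose (A : Matrix (Fin m) (Fin n) ℝ) (u : Vec n) (v : Vec m) :
    inner ℝ u (app Aᵀ v) = inner ℝ (app A u) v := by
  simp only [app, EuclideanSpace.inner_eq_star_dotProduct, star_trivial]
  rw [Matrix.mulVec_transpose, ← Matrix.dotProduct_mulVec]

@[simp] theorem restrict_apply (u : Vec n) (Ω : Finset (Fin n)) (i : Fin n) :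
    restrict u Ω i = if i ∈ Ω then u i else 0 := rfl

@[simp] theorem hadamard_apply (u w : Vec n) (i : Fin n) : hadamard u w i = u i * w i := rfl

@[simp] theorem mem_supp {u : Vec n} {i : Fin n} : i ∈ supp u ↔ u i ≠ 0 := by
  simp [supp]

theorem restrict_add (u v : Vec n) (Ω : Finset (Fin n)) :
    restrict (u + v) Ω = restrict u Ω + restrict v Ω := by
  ext i; by_cases h : i ∈ Ω <;> simp [h]

theorem restrict_sub (u v : Vec n) (Ω : Finset (Fin n)) :
    restrict (u - v) Ω = restrict u Ω - restrict v Ω := by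
  ext i; by_cases h : i ∈ Ω <;> simp [h]

theorem restrict_smul (r : ℝ) (u : Vec n) (Ω : Finset (Fin n)) :
    restrict (r • u) Ω = r • restrict u Ω := by
  ext i; by_cases h : i ∈ Ω <;> simp [h]

theorem restrict_add_restrict_compl (u : Vec n) (Ω : Finset (Fin n)) :
    restrict u Ω + restrict u Ωᶜ = u := by
  ext i; by_cases h : i ∈ Ω <;> simp [h]

theorem supp_restrict_subset (u : Vec n) (Ω : Finset (Fin n)) : supp (restrict u Ω) ⊆ Ω := by
  intro i hi
  by_contra h
  simp [h] at hi

theorem supp_add_subset (u v : Vec n) : supp (u + v) ⊆ supp u ∪ supp v := by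
  intro i hi
  by_contra h
  simp_all

theorem supp_sub_subset (u v : Vec n) : supp (u - v) ⊆ supp u ∪ supp v := by
  intro i hi
  by_contra h
  simp_all

theorem supp_smul_subset (r : ℝ) (u : Vec n) : supp (r • u) ⊆ supp u := by
  intro i hi
  by_contra h
  simp_all

theorem isSparse_restrict {k : ℕ} (u : Vec n) {Ω : Finset (Fin n)} (h : Ω.card ≤ k) :
    IsSparse k (restrict u Ω) :=
  (Finset.card_le_card (supp_restrict_subset u Ω)).trans h

theorem norm_le_of_abs_le {u v : Vec n} (h : ∀ i, |u i| ≤ |v i|) : ‖u‖ ≤ ‖v‖ := by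
  rw [EuclideanSpace.norm_eq, EuclideanSpace.norm_eq]
  exact Real.sqrt_le_sqrt (Finset.sum_le_sum fun i _ => by
    simpa using sq_le_sq.2 (h i))

theorem norm_restrict_le (u : Vec n) (Ω : Finset (Fin n)) : ‖restrict u Ω‖ ≤ ‖u‖ :=
  norm_le_of_abs_le fun i => by by_cases h : i ∈ Ω <;> simp [h]

theorem norm_restrict_sq (u : Vec n) (Ω : Finset (Fin n)) :
    ‖restrict u Ω‖ ^ 2 = ∑ i ∈ Ω, u i ^ 2 := by
  simp [EuclideanSpace.real_norm_sq_eq, ite_pow, Finset.sum_ite_mem]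

theorem inner_restrict_self (u : Vec n) (Ω : Finset (Fin n)) :
    inner ℝ (restrict u Ω) u = ‖restrict u Ω‖ ^ 2 := by
  rw [norm_restrict_sq]
  simp [PiLp.inner_apply, sq, Finset.sum_ite_mem]

/-! ### The restricted isometry constant -/

section RIC

variable (A : Matrix (Fin m) (Fin n) ℝ)

theorem ric_nonneg (k : ℕ) : 0 ≤ ric A k := (isLeast_ric A k).1.1

theorem ric_mono {j k : ℕ} (h : j ≤ k) : ric A j ≤ ric A k :=
  (isLeast_ric A j).2 ⟨ric_nonneg A k, fun u hu => (isLeast_ric A k).1.2 u (hu.trans h)⟩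

theorem norm_app_le {k : ℕ} {u : Vec n} (hu : IsSparse k u) :
    ‖app A u‖ ≤ √(1 + ric A k) * ‖u‖ := by
  have h := ((isLeast_ric A k).1.2 u hu).2
  have h0 := ric_nonneg A k
  refine abs_le_of_sq_le_sq' ?_ (by positivity) |>.2
  rwa [mul_pow, Real.sq_sqrt (by linarith)]

theorem le_norm_app {k : ℕ} {u : Vec n} (hu : IsSparse k u) (h1 : ric A k ≤ 1) :
    √(1 - ric A k) * ‖u‖ ≤ ‖app A u‖ := by
  have h := ((isLeast_ric A k).1.2 u hu).1
  refine abs_le_of_sq_le_sq' ?_ (by positivity) |>.2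
  rwa [mul_pow, Real.sq_sqrt (by linarith)]

/-- Polarization: subtract the lower isometry bound for `u - v` from the upper one for `u + v`. -/
theorem two_mul_inner_app_sub_inner_le {k : ℕ} {u v : Vec n}
    (h : (supp u ∪ supp v).card ≤ k) :
    2 * (inner ℝ (app A u) (app A v) - inner ℝ u v) ≤ ric A k * (‖u‖ ^ 2 + ‖v‖ ^ 2) := by
  have h1 := ((isLeast_ric A k).1.2 (u + v)
    ((Finset.card_le_card (supp_add_subset u v)).trans h)).2
  have h2 := ((isLeast_ric A k).1.2 (u - v)
    ((Finset.card_le_card (supp_sub_subset u v)).trans h)).1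
  rw [app_add, norm_add_sq_real, norm_add_sq_real] at h1
  rw [app_sub, norm_sub_sq_real, norm_sub_sq_real] at h2
  linarith

theorem inner_app_sub_inner_le {k : ℕ} {u v : Vec n}
    (h : (supp u ∪ supp v).card ≤ k) :
    inner ℝ (app A u) (app A v) - inner ℝ u v ≤ ric A k * (‖u‖ * ‖v‖) := by
  rcases eq_or_ne u 0 with rfl | hu
  · have : app A (0 : Vec n) = 0 := map_zero (Matrix.toEuclideanLin A)
    simp [this]
  rcases eq_or_ne v 0 with rfl | hv
  · have : app A (0 : Vec n) = 0 := map_zero (Matrix.toEuclideanLin A)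
    simp [this]
  have hu' := norm_pos_iff.2 hu
  have hv' := norm_pos_iff.2 hv
  -- Rescaling both vectors to the common norm `‖u‖‖v‖` turns the sum of squares into twice the
  -- product of the norms.
  have key := two_mul_inner_app_sub_inner_le A (k := k) (u := ‖v‖ • u) (v := ‖u‖ • v)
    ((Finset.card_le_card
      (Finset.union_subset_union (supp_smul_subset _ _) (supp_smul_subset _ _))).trans h)
  rw [app_smul, app_smul] at key
  simp only [inner_smul_left, inner_smul_right, norm_smul, norm_norm, conj_trivial] at key
  have hp : 0 < ‖u‖ * ‖v‖ := mul_pos hu' hv'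
  refine le_of_mul_le_mul_left ?_ hp
  linarith

theorem inner_sub_inner_app_le {k : ℕ} {u v : Vec n}
    (h : (supp u ∪ supp v).card ≤ k) :
    inner ℝ u v - inner ℝ (app A u) (app A v) ≤ ric A k * (‖u‖ * ‖v‖) := by
  have key := inner_app_sub_inner_le A (k := k) (u := (-1 : ℝ) • u) (v := v)
    ((Finset.card_le_card
      (Finset.union_subset_union (supp_smul_subset _ _) subset_rfl)).trans h)
  rw [app_smul] at key
  simp only [inner_smul_left, norm_smul, conj_trivial, norm_neg, norm_one, one_mul] at key
  linarith

/-- Test `(I - AᵀA)e` against its own restriction `r`: this gives `‖r‖² = ⟨r, e⟩ - ⟨Ar, Ae⟩`, which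
near-isometry bounds by `δ‖r‖‖e‖`. -/
theorem norm_restrict_sub_normal_le {k : ℕ} {e : Vec n} {Ω : Finset (Fin n)}
    (h : (Ω ∪ supp e).card ≤ k) :
    ‖restrict (e - app Aᵀ (app A e)) Ω‖ ≤ ric A k * ‖e‖ := by
  set r := restrict (e - app Aᵀ (app A e)) Ω with hr
  have h1 : ‖r‖ ^ 2 = inner ℝ r e - inner ℝ (app A r) (app A e) := by
    rw [← inner_app_transpose, ← inner_sub_right, hr, inner_restrict_self]
  have h2 := inner_sub_inner_app_le A (k := k) (u := r) (v := e)
    ((Finset.card_le_card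
      (Finset.union_subset_union (supp_restrict_subset _ _) subset_rfl)).trans h)
  rcases (norm_nonneg r).eq_or_lt with h0 | h0
  · rw [← h0]; exact mul_nonneg (ric_nonneg A k) (norm_nonneg e)
  · refine le_of_mul_le_mul_left ?_ h0
    nlinarith

theorem norm_restrict_transpose_le {k : ℕ} (v : Vec m) {Ω : Finset (Fin n)}
    (h : Ω.card ≤ k) :
    ‖restrict (app Aᵀ v) Ω‖ ≤ √(1 + ric A k) * ‖v‖ := by
  set r := restrict (app Aᵀ v) Ω with hr
  have h1 : ‖r‖ ^ 2 = inner ℝ (app A r) v := by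
    rw [← inner_app_transpose, hr, inner_restrict_self]
  have h2 := real_inner_le_norm (app A r) v
  have h3 := norm_app_le A (isSparse_restrict (app Aᵀ v) h)
  rw [← hr] at h3
  rcases (norm_nonneg r).eq_or_lt with h0 | h0
  · rw [← h0]; positivity
  · refine le_of_mul_le_mul_left ?_ h0
    nlinarith [mul_le_mul_of_nonneg_right h3 (norm_nonneg v)]

/-- If the constant vanished, `A` would preserve inner products of basis vectors and yield `n`
orthonormal vectors in `ℝᵐ` with `m < n`. Positivity of `δ_{2k}` keeps the denominators in `d₂`,
`b₂`, `b₃` nonzero, even for `ω = 1`. -/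
theorem ric_pos (hmn : m < n) {k : ℕ} (hk : 2 ≤ k) : 0 < ric A k := by
  refine (ric_nonneg A k).lt_of_ne fun h0 => ?_
  have hs : ∀ i : Fin n, (supp (EuclideanSpace.single i (1 : ℝ) : Vec n)).card ≤ 1 := fun i => by
    refine Finset.card_le_one.2 fun a ha b hb => ?_
    have ha' : a = i := by by_contra h; simp [h] at ha
    have hb' : b = i := by by_contra h; simp [h] at hb
    rw [ha', hb']
  have hon : Orthonormal ℝ fun i : Fin n => app A (EuclideanSpace.single i (1 : ℝ)) := by
    rw [orthonormal_iff_ite]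
    intro i j
    have hc : (supp (EuclideanSpace.single i (1 : ℝ) : Vec n) ∪
        supp (EuclideanSpace.single j (1 : ℝ) : Vec n)).card ≤ k :=
      (Finset.card_union_le _ _).trans ((add_le_add (hs i) (hs j)).trans hk)
    have h1 := inner_app_sub_inner_le A hc
    have h2 := inner_sub_inner_app_le A hc
    rw [← h0, zero_mul] at h1 h2
    rw [← orthonormal_iff_ite.1 (EuclideanSpace.orthonormal_single (𝕜 := ℝ) (ι := Fin n)) i j]
    linarith
  have := hon.linearIndependent.fintype_card_le_finrank
  simp at this
  omega

end RIC

/-! ### Splitting an index set into blocks of decreasing weight -/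

theorem exists_top_subset {ι : Type*} [DecidableEq ι] (w : ι → ℝ) (k : ℕ) (U : Finset ι)
    (h : k ≤ U.card) :
    ∃ B ⊆ U, B.card = k ∧ ∀ i ∈ B, ∀ j ∈ U \ B, w j ≤ w i := by
  induction k with
  | zero => exact ⟨∅, by simp⟩
  | succ k ih =>
    obtain ⟨B, hBU, hBk, hB⟩ := ih (by omega)
    have hne : (U \ B).Nonempty := by
      rw [← Finset.card_pos, Finset.card_sdiff_of_subset hBU]; omega
    obtain ⟨a, ha, hmax⟩ := Finset.exists_max_image (U \ B) w hne
    rw [Finset.mem_sdiff] at ha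
    refine ⟨insert a B, Finset.insert_subset ha.1 hBU, by simp [ha.2, hBk], ?_⟩
    intro i hi j hj
    simp only [Finset.mem_sdiff, Finset.mem_insert, not_or] at hj hi
    have hj' : j ∈ U \ B := by simp [hj]
    rcases hi with rfl | hi
    · exact hmax j hj'
    · exact hB i hi j hj'

/-- Peel off the `k` heaviest indices repeatedly. The bound `a` of each block after the first is the
smallest weight of the block before it, so `k * a` is at most the total weight of that earlier
block; only the first bound `M` is not paid for. With `M = 1` and total weight at most `k`, the
bounds sum to at most `2`. -/
theorem exists_block_coloring {ι : Type*} [DecidableEq ι] {k : ℕ} (hk : 1 ≤ k) (w : ι → ℝ)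
    (hw : ∀ i, 0 ≤ w i) (U : Finset ι) (M : ℝ) (hM : 0 ≤ M) (hU : ∀ i ∈ U, w i ≤ M) :
    ∃ (N : ℕ) (col : ι → ℕ) (a : ℕ → ℝ), (∀ i ∈ U, col i < N) ∧
      (∀ b, (U.filter (col · = b)).card ≤ k) ∧ (∀ i ∈ U, w i ≤ a (col i)) ∧
      (∀ b, 0 ≤ a b ∧ a b ≤ M) ∧ k * ∑ b ∈ Finset.range N, a b ≤ k * M + ∑ i ∈ U, w i := by
  induction hc : U.card using Nat.strong_induction_on generalizing U M with
  | _ c ih =>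
    rcases le_or_gt U.card k with h | h
    · refine ⟨1, fun _ => 0, fun _ => M, by simp, fun b => ?_, hU, fun _ => ⟨hM, le_rfl⟩, ?_⟩
      · exact (Finset.card_le_card (Finset.filter_subset _ _)).trans h
      · simpa using Finset.sum_nonneg fun i _ => hw i
    · obtain ⟨B, hBU, hBk, hB⟩ := exists_top_subset w k U h.le
      have hBne : B.Nonempty := by rw [← Finset.card_pos]; omega
      obtain ⟨b₀, hb₀, hmin⟩ := Finset.exists_min_image B w hBne
      obtain ⟨N, col, a, hN, hcard, hle, ha, hsum⟩ := ih (U \ B).card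
        (by rw [Finset.card_sdiff_of_subset hBU]; omega) (U \ B) (w b₀) (hw b₀)
        (fun j hj => hB b₀ hb₀ j hj) rfl
      have hb₀M := hU b₀ (hBU hb₀)
      -- The peeled block takes colour `0` with bound `M`; the colours of the remainder shift by
      -- one.
      refine ⟨N + 1, fun i => if i ∈ B then 0 else col i + 1,
        fun b => b.casesOn M a, ?_, ?_, ?_, ?_, ?_⟩
      · intro i hi
        by_cases hiB : i ∈ B
        · simp [hiB]
        · simpa [hiB] using hN i (by simp [hi, hiB])
      · rintro (_ | b)
        · refine (Finset.card_le_card ?_).trans hBk.le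
          intro i hi
          by_contra hiB
          simp [hiB] at hi
        · refine (Finset.card_le_card ?_).trans (hcard b)
          intro i hi
          by_cases hiB : i ∈ B
          · simp [hiB] at hi
          · simpa [hiB] using hi
      · intro i hi
        by_cases hiB : i ∈ B
        · simpa [hiB] using hU i hi
        · simpa [hiB] using hle i (by simp [hi, hiB])
      · rintro (_ | b)
        · exact ⟨hM, le_rfl⟩
        · exact ⟨(ha b).1, (ha b).2.trans hb₀M⟩
      · rw [Finset.sum_range_succ']
        have h1 : (k : ℝ) * w b₀ ≤ ∑ i ∈ B, w i := by
          have := Finset.card_nsmul_le_sum B w (w b₀) hmin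
          rwa [hBk, nsmul_eq_mul] at this
        have h2 := Finset.sum_sdiff (f := w) hBU
        change (k : ℝ) * (∑ b ∈ Finset.range N, a b + M) ≤ _
        linarith

/-! ### Weighted sums over blocks -/

theorem sum_restrict_coloring (u : Vec n) {U : Finset (Fin n)} {N : ℕ} {col : Fin n → ℕ}
    (h : ∀ i ∈ U, col i < N) :
    ∑ b ∈ Finset.range N, restrict u (U.filter (col · = b)) = restrict u U := by
  ext i
  simp only [WithLp.ofLp_sum, Finset.sum_apply, restrict_apply, Finset.mem_filter]
  by_cases hi : i ∈ U
  · simp [hi, h i hi]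
  · simp [hi]

theorem sum_norm_restrict_coloring_sq_le (u : Vec n) (U : Finset (Fin n)) (N : ℕ)
    (col : Fin n → ℕ) :
    ∑ b ∈ Finset.range N, ‖restrict u (U.filter (col · = b))‖ ^ 2 ≤ ‖u‖ ^ 2 := by
  simp_rw [norm_restrict_sq, Finset.sum_filter]
  rw [EuclideanSpace.real_norm_sq_eq, Finset.sum_comm]
  refine (Finset.sum_le_sum fun i _ => ?_).trans
    (Finset.sum_le_univ_sum_of_nonneg fun i => sq_nonneg (u i))
  rw [Finset.sum_ite_eq]
  split_ifs
  · exact le_rfl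
  · exact sq_nonneg _

/-- Cauchy–Schwarz over disjoint blocks. As `0 ≤ a b ≤ 1`, squaring does not increase the `a b`, so
their squares also sum to at most `2`; hence the `√2`. -/
theorem sum_mul_norm_restrict_coloring_le (u : Vec n) (U : Finset (Fin n)) (N : ℕ)
    (col : Fin n → ℕ) {a : ℕ → ℝ} (ha : ∀ b, 0 ≤ a b ∧ a b ≤ 1)
    (hsum : ∑ b ∈ Finset.range N, a b ≤ 2) :
    ∑ b ∈ Finset.range N, a b * ‖restrict u (U.filter (col · = b))‖ ≤ √2 * ‖u‖ := by
  have h1 := Finset.sum_mul_sq_le_sq_mul_sq (Finset.range N) a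
    fun b => ‖restrict u (U.filter (col · = b))‖
  have h2 := sum_norm_restrict_coloring_sq_le u U N col
  have h3 : ∑ b ∈ Finset.range N, a b ^ 2 ≤ 2 :=
    (Finset.sum_le_sum fun b _ => by nlinarith [ha b]).trans hsum
  refine abs_le_of_sq_le_sq' ?_ (by positivity) |>.2
  rw [mul_pow, Real.sq_sqrt (by norm_num)]
  exact h1.trans (mul_le_mul h3 h2 (Finset.sum_nonneg fun b _ => by positivity) (by norm_num))

/-! ### The error of one iteration -/

/-- The error of the heavy-ball point with respect to `s` when `y = A s + ν`. -/
theorem heavyBall_sub_eq (A : Matrix (Fin m) (Fin n) ℝ) (α β : ℝ) (s x' x : Vec n) (ν : Vec m) :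
    heavyBall A (app A s + ν) α β x' x - s =
      (1 - α + β) • (x - s) + α • ((x - s) - app Aᵀ (app A (x - s))) - β • (x' - s) +
        α • app Aᵀ ν := by
  have h : app A x - (app A s + ν) = app A (x - s) - ν := by rw [app_sub]; abel
  rw [heavyBall, h, app_sub]
  module

theorem norm_restrict_heavyBall_sub_le (A : Matrix (Fin m) (Fin n) ℝ) {k j : ℕ} {α β : ℝ}
    (hα : 0 ≤ α) (hβ : 0 ≤ β) (s x' x : Vec n) (ν : Vec m) {Ω : Finset (Fin n)}
    (hΩ : Ω.card ≤ k) (hj : (Ω ∪ supp (x - s)).card ≤ j) :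
    ‖restrict (heavyBall A (app A s + ν) α β x' x - s) Ω‖ ≤
      |1 - α + β| * ‖restrict (x - s) Ω‖ + α * (ric A j * ‖x - s‖) +
        β * ‖restrict (x' - s) Ω‖ + α * (√(1 + ric A k) * ‖ν‖) := by
  rw [heavyBall_sub_eq, restrict_add, restrict_sub, restrict_add, restrict_smul, restrict_smul,
    restrict_smul, restrict_smul]
  refine (norm_add_le _ _).trans (add_le_add ((norm_sub_le _ _).trans
    (add_le_add ((norm_add_le _ _).trans (add_le_add ?_ ?_)) ?_)) ?_)
  · rw [norm_smul, Real.norm_eq_abs]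
  · rw [norm_smul, Real.norm_eq_abs, abs_of_nonneg hα]
    exact mul_le_mul_of_nonneg_left (norm_restrict_sub_normal_le A hj) hα
  · rw [norm_smul, Real.norm_eq_abs, abs_of_nonneg hβ]
  · rw [norm_smul, Real.norm_eq_abs, abs_of_nonneg hα]
    exact mul_le_mul_of_nonneg_left (norm_restrict_transpose_le A ν hΩ) hα

theorem card_union_supp_sub_le {k : ℕ} {s x : Vec n} {S Ω : Finset (Fin n)} {j : ℕ}
    (hs : supp s ⊆ S) (hx : IsSparse k x) (h : (Ω ∪ S).card ≤ j) :
    (Ω ∪ supp (x - s)).card ≤ j + k := by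
  have hsub : Ω ∪ supp (x - s) ⊆ (Ω ∪ S) ∪ supp x := by
    intro i hi
    rw [Finset.mem_union] at hi
    rcases hi with hi | hi
    · simp [hi]
    · rcases Finset.mem_union.1 (supp_sub_subset x s hi) with h' | h'
      · simp only [Finset.mem_union]; exact Or.inr h'
      · simp [hs h']
  exact (Finset.card_le_card hsub).trans
    ((Finset.card_union_le _ _).trans (add_le_add h hx))

/-- The part of a compressed heavy-ball point outside the support of the target. -/
theorem norm_app_restrict_compressed_le (A : Matrix (Fin m) (Fin n) ℝ) {k : ℕ} (hk : 1 ≤ k)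
    {α β : ℝ} (hα : 0 ≤ α) (hβ : 0 ≤ β) {s x' x : Vec n} (ν : Vec m) {S : Finset (Fin n)}
    (hs : supp s ⊆ S) (hS : S.card ≤ k) (hx : IsSparse k x) {w v : Vec n}
    (hw : w ∈ polytope n k)
    (hv : ∀ i, |v i| ≤ w i * |heavyBall A (app A s + ν) α β x' x i|)
    {U : Finset (Fin n)} (hU : Disjoint U S) :
    ‖app A (restrict v U)‖ ≤ √(1 + ric A k) *
      ((√2 * |1 - α + β| + 2 * α * ric A (3 * k)) * ‖x - s‖ + β * √2 * ‖x' - s‖ +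
        2 * α * √(1 + ric A k) * ‖ν‖) := by
  obtain ⟨N, col, a, hN, hcard, hle, ha, hsum⟩ :=
    exists_block_coloring hk (fun i => w i) (fun i => (hw.2 i).1) U 1 zero_le_one
      fun i _ => (hw.2 i).2
  have hsum2 : ∑ b ∈ Finset.range N, a b ≤ 2 := by
    have h1 : ∑ i ∈ U, w i ≤ k :=
      (Finset.sum_le_univ_sum_of_nonneg fun i => (hw.2 i).1).trans hw.1.le
    have hk' : (0 : ℝ) < k := by exact_mod_cast hk
    refine le_of_mul_le_mul_left ?_ hk'
    linarith
  set u := heavyBall A (app A s + ν) α β x' x with hu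
  set Bl : ℕ → Finset (Fin n) := fun b => U.filter (col · = b) with hBl
  set r := √(1 + ric A k)
  have hblock : ∀ b, ‖app A (restrict v (Bl b))‖ ≤ r * (a b *
      (|1 - α + β| * ‖restrict (x - s) (Bl b)‖ + α * (ric A (3 * k) * ‖x - s‖) +
        β * ‖restrict (x' - s) (Bl b)‖ + α * (r * ‖ν‖))) := by
    intro b
    refine (norm_app_le A (isSparse_restrict v (hcard b))).trans
      (mul_le_mul_of_nonneg_left ?_ (Real.sqrt_nonneg _))
    -- The block misses `S`, where `s` is supported, so `u` and `u - s` agree on it.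
    have h1 : ‖restrict v (Bl b)‖ ≤ ‖a b • restrict (u - s) (Bl b)‖ := by
      refine norm_le_of_abs_le fun i => ?_
      by_cases hi : i ∈ Bl b
      · have hi' := Finset.mem_filter.1 hi
        have hsi : s i = 0 := by
          by_contra hne
          exact Finset.disjoint_left.1 hU hi'.1 (hs (mem_supp.2 hne))
        have h3 := hle i hi'.1
        rw [hi'.2] at h3
        simp only [restrict_apply, hi, if_true, PiLp.smul_apply, PiLp.sub_apply, hsi, sub_zero,
          smul_eq_mul, abs_mul, abs_of_nonneg (ha b).1]
        exact (hv i).trans (mul_le_mul_of_nonneg_right h3 (abs_nonneg _))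
      · simp [hi]
    refine h1.trans ?_
    rw [norm_smul, Real.norm_eq_abs, abs_of_nonneg (ha b).1]
    refine mul_le_mul_of_nonneg_left ?_ (ha b).1
    refine norm_restrict_heavyBall_sub_le A hα hβ s x' x ν (hcard b) ?_
    -- The block, `S` and the support of `x` have at most `k` elements each, hence `δ_{3k}`.
    have := card_union_supp_sub_le (Ω := Bl b) hs hx
      ((Finset.card_union_le _ _).trans (add_le_add (hcard b) hS))
    exact this.trans (by omega)
  rw [← sum_restrict_coloring v hN, app_sum]
  refine (norm_sum_le _ _).trans ((Finset.sum_le_sum fun b _ => hblock b).trans ?_)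
  rw [← Finset.mul_sum]
  refine mul_le_mul_of_nonneg_left ?_ (Real.sqrt_nonneg _)
  have e1 := sum_mul_norm_restrict_coloring_le (x - s) U N col ha hsum2
  have e2 := sum_mul_norm_restrict_coloring_le (x' - s) U N col ha hsum2
  have hric := ric_nonneg A (3 * k)
  calc ∑ b ∈ Finset.range N, a b *
      (|1 - α + β| * ‖restrict (x - s) (Bl b)‖ + α * (ric A (3 * k) * ‖x - s‖) +
        β * ‖restrict (x' - s) (Bl b)‖ + α * (r * ‖ν‖))
      = |1 - α + β| * ∑ b ∈ Finset.range N, a b * ‖restrict (x - s) (Bl b)‖ +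
        (∑ b ∈ Finset.range N, a b) * (α * (ric A (3 * k) * ‖x - s‖)) +
        β * ∑ b ∈ Finset.range N, a b * ‖restrict (x' - s) (Bl b)‖ +
        (∑ b ∈ Finset.range N, a b) * (α * (r * ‖ν‖)) := by
          simp only [Finset.mul_sum, Finset.sum_mul, ← Finset.sum_add_distrib]
          exact Finset.sum_congr rfl fun b _ => by ring
    _ ≤ |1 - α + β| * (√2 * ‖x - s‖) + 2 * (α * (ric A (3 * k) * ‖x - s‖)) +
        β * (√2 * ‖x' - s‖) + 2 * (α * (r * ‖ν‖)) := by
          gcongr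
    _ = _ := by ring

theorem abs_compressed_le {k j : ℕ} {u : Vec n} {w : ℕ → Vec n}
    (hw : ∀ i, 1 ≤ i → i ≤ j → w i ∈ polytope n k) (i : Fin n) :
    |compressed u w j i| ≤ |u i| := by
  induction j with
  | zero => exact le_rfl
  | succ j ih =>
    have h := (hw (j + 1) (by omega) le_rfl).2 i
    have h1 := ih fun l h1 h2 => hw l h1 (by omega)
    rw [compressed, hadamard_apply, abs_mul, abs_of_nonneg h.1]
    nlinarith [abs_nonneg (compressed u w j i)]

theorem abs_compressed_succ_le {k j : ℕ} {u : Vec n} {w : ℕ → Vec n}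
    (hw : ∀ i, 1 ≤ i → i ≤ j + 1 → w i ∈ polytope n k) (i : Fin n) :
    |compressed u w (j + 1) i| ≤ w (j + 1) i * |u i| := by
  have h := (hw (j + 1) (by omega) le_rfl).2 i
  have h1 := abs_compressed_le (u := u) (j := j) (fun l h1 h2 => hw l h1 (by omega)) i
  rw [compressed, hadamard_apply, abs_mul, abs_of_nonneg h.1, mul_comm]
  exact mul_le_mul_of_nonneg_left h1 h.1

theorem norm_residual_compressed_succ_le {A : Matrix (Fin m) (Fin n) ℝ} {y : Vec m} {k ω : ℕ}
    {u : Vec n} {w : ℕ → Vec n} (h : IsCompression A y k ω u w) {j : ℕ} (hj : j < ω)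
    {S : Finset (Fin n)} (hS : S.card = k) :
    ‖y - app A (compressed u w (j + 1))‖ ≤ ‖y - app A (restrict (compressed u w j) S)‖ := by
  -- The indicator of `S` is a feasible weight because `S` has exactly `k` elements.
  let χ : Vec n := WithLp.toLp 2 fun i => if i ∈ S then 1 else 0
  have hχ : χ ∈ polytope n k := by
    refine ⟨by simp [χ, hS], fun i => ?_⟩
    by_cases hi : i ∈ S <;> simp [χ, hi]
  have h1 : hadamard (compressed u w j) χ = restrict (compressed u w j) S := by
    ext i; by_cases hi : i ∈ S <;> simp [χ, hi]
  have h2 := (h j hj).2 hχ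
  simp only [Set.mem_ofPred_eq, h1] at h2
  exact abs_le_of_sq_le_sq' h2 (norm_nonneg _) |>.2

/-- Thresholding discards `v` on `S \ L`. Since `S` and `L` have equal size, a bijection pairs these
entries with those of `L \ S`, which are at least as large in absolute value. -/
theorem norm_sub_hardThresholding_le {k : ℕ} {v s : Vec n} {S L : Finset (Fin n)}
    (hs : supp s ⊆ S) (hS : S.card = k) (hL : IsLargest k v L) :
    ‖restrict v L - s‖ ≤ ‖restrict (s - v) (S ∪ L)‖ + ‖restrict v (L \ S)‖ := by
  have hzero : ∀ i, i ∉ S → s i = 0 := fun i hi => by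
    by_contra hne
    exact hi (hs (mem_supp.2 hne))
  have heq : restrict v L - s = -(restrict (s - v) (S ∪ L)) - restrict v (S \ L) := by
    ext i
    by_cases h1 : i ∈ S <;> by_cases h2 : i ∈ L <;> simp [h1, h2]
    exact hzero i h1
  have hle : ‖restrict v (S \ L)‖ ≤ ‖restrict v (L \ S)‖ := by
    refine abs_le_of_sq_le_sq' ?_ (norm_nonneg _) |>.2
    rw [norm_restrict_sq, norm_restrict_sq]
    have hcard : (S \ L).card = (L \ S).card := by
      have h1 := Finset.card_sdiff_add_card_inter S L
      have h2 := Finset.card_sdiff_add_card_inter L S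
      rw [Finset.inter_comm] at h2
      have h3 := hL.1
      omega
    let φ := Finset.equivOfCardEq hcard
    rw [← Finset.sum_coe_sort (S \ L), ← Finset.sum_coe_sort (L \ S), ← Equiv.sum_comp φ]
    refine Finset.sum_le_sum fun i _ => sq_le_sq.2 ?_
    exact hL.2 _ (Finset.mem_sdiff.1 (φ i).2).1 _ (Finset.mem_sdiff.1 i.2).2
  rw [heq]
  refine (norm_sub_le _ _).trans ?_
  rw [norm_neg]
  exact add_le_add le_rfl hle

/-- One step of `HBROTω`, in terms of the restricted isometry constants only. -/
theorem norm_sharp_sub_le (A : Matrix (Fin m) (Fin n) ℝ) {k ω : ℕ} (hk : 1 ≤ k) (hω : 1 ≤ ω)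
    {α β : ℝ} (hα : 0 ≤ α) (hβ : 0 ≤ β) (h1 : ric A (2 * k) < 1) {s x' x xs : Vec n} (ν : Vec m)
    {S : Finset (Fin n)} (hs : supp s ⊆ S) (hS : S.card = k) (hx : IsSparse k x)
    (h : IsSharp A (app A s + ν) k ω α β x' x xs) :
    ‖xs - s‖ ≤
      (2 * ‖ν‖ + √(1 + ric A k) * (
        (|1 - α + β| + α * ric A (2 * k)) * ‖x - s‖ + β * ‖x' - s‖ + α * √(1 + ric A k) * ‖ν‖ +
        ω * ((√2 * |1 - α + β| + 2 * α * ric A (3 * k)) * ‖x - s‖ + β * √2 * ‖x' - s‖ +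
          2 * α * √(1 + ric A k) * ‖ν‖))) / √(1 - ric A (2 * k)) +
      ((|1 - α + β| + α * ric A (3 * k)) * ‖x - s‖ + β * ‖x' - s‖ +
        α * √(1 + ric A k) * ‖ν‖) := by
  obtain ⟨w, hw, L, hL, rfl⟩ := h
  set u := heavyBall A (app A s + ν) α β x' x with hu
  set r := √(1 + ric A k) with hr
  have hr0 : 0 ≤ r := Real.sqrt_nonneg _
  set D := (√2 * |1 - α + β| + 2 * α * ric A (3 * k)) * ‖x - s‖ + β * √2 * ‖x' - s‖ +
          2 * α * r * ‖ν‖ with hD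
  set R := (|1 - α + β| + α * ric A (2 * k)) * ‖x - s‖ + β * ‖x' - s‖ + α * r * ‖ν‖ with hR
  have hpoly : ∀ i, 1 ≤ i → i ≤ ω → w i ∈ polytope n k := fun i hi1 hi2 => by
    have := (hw (i - 1) (by omega)).1
    rwa [Nat.sub_add_cancel hi1] at this
  have htail : ∀ j, j < ω → ∀ U : Finset (Fin n), Disjoint U S →
      ‖app A (restrict (compressed u w (j + 1)) U)‖ ≤ r * D := fun j hj U hU =>
    norm_app_restrict_compressed_le A hk hα hβ ν hs hS.le hx (hpoly (j + 1) (by omega) (by omega))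
      (abs_compressed_succ_le fun i hi1 hi2 => hpoly i hi1 (by omega)) hU
  have hinit : ‖restrict (u - s) S‖ ≤ R := by
    have hc := card_union_supp_sub_le (Ω := S) (j := k) hs hx (by simp [hS])
    rw [← two_mul] at hc
    refine (norm_restrict_heavyBall_sub_le A hα hβ s x' x ν hS.le hc).trans ?_
    have e1 := mul_le_mul_of_nonneg_left (norm_restrict_le (x - s) S) (abs_nonneg (1 - α + β))
    have e2 := mul_le_mul_of_nonneg_left (norm_restrict_le (x' - s) S) hβ
    rw [hR]
    linarith
  have hrs : restrict s S = s := by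
    ext i
    by_cases hi : i ∈ S
    · simp [hi]
    · have : s i = 0 := by
        by_contra hne
        exact hi (hs (mem_supp.2 hne))
      simp [hi, this]
  -- The first compression costs the error of `u` on `S`. Each later one replaces the current vector
  -- by its restriction to `S`, which costs one tail `r * D`.
  have hres : ∀ j, j < ω →
      ‖app A s + ν - app A (compressed u w (j + 1))‖ ≤ ‖ν‖ + r * R + j * (r * D) := by
    intro j
    induction j with
    | zero =>
      intro hj
      refine (norm_residual_compressed_succ_le hw hj hS).trans ?_
      have e : app A s + ν - app A (restrict (compressed u w 0) S) =
          ν - app A (restrict (u - s) S) := by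
        rw [restrict_sub, app_sub, hrs, compressed]; abel
      rw [e]
      refine (norm_sub_le _ _).trans ?_
      have e2 := (norm_app_le A (isSparse_restrict (u - s) hS.le)).trans
        (mul_le_mul_of_nonneg_left hinit hr0)
      simp only [Nat.cast_zero, zero_mul, add_zero]
      linarith
    | succ j ih =>
      intro hj
      refine (norm_residual_compressed_succ_le hw hj hS).trans ?_
      have e : app A s + ν - app A (restrict (compressed u w (j + 1)) S) =
          app A s + ν - app A (compressed u w (j + 1)) +
            app A (restrict (compressed u w (j + 1)) Sᶜ) := by
        conv_rhs => enter [1, 2]; rw [← restrict_add_restrict_compl (compressed u w (j + 1)) S,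
          app_add]
        abel
      rw [e]
      refine (norm_add_le _ _).trans ?_
      have e1 := ih (by omega)
      have e2 := htail j (by omega) Sᶜ disjoint_compl_left
      push_cast
      linarith
  obtain ⟨q, rfl⟩ : ∃ q, ω = q + 1 := ⟨ω - 1, by omega⟩
  set v := compressed u w (q + 1) with hv
  refine (norm_sub_hardThresholding_le hs hS hL).trans (add_le_add ?_ ?_)
  · rw [le_div_iff₀ (Real.sqrt_pos.2 (by linarith)), mul_comm]
    have hcard : (S ∪ L).card ≤ 2 * k :=
      (Finset.card_union_le _ _).trans (by rw [hS, hL.1]; omega)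
    refine (le_norm_app A (isSparse_restrict (s - v) hcard) h1.le).trans ?_
    have hrs' : restrict s (S ∪ L) = s := by
      ext i
      by_cases hi : i ∈ S ∪ L
      · simp [hi]
      · have hi' := congrArg (fun z : Vec n => z i) hrs
        have hiS : i ∉ S := fun h => hi (Finset.mem_union_left _ h)
        simp only [restrict_apply, hiS, if_false] at hi'
        simp only [restrict_apply, hi, if_false, hi']
    -- Removing the part of `v` off `S ∪ L` adds one more tail to the `ω - 1` already in the
    -- residual, which gives the factor `ω`; `ν` now occurs twice.
    have e : app A (restrict (s - v) (S ∪ L)) =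
        (app A s + ν - app A v) - ν + app A (restrict v (S ∪ L)ᶜ) := by
      conv_rhs => enter [1, 1, 2]; rw [← restrict_add_restrict_compl v (S ∪ L), app_add]
      rw [restrict_sub, app_sub, hrs']
      abel
    rw [e]
    refine (norm_add_le _ _).trans ((add_le_add (norm_sub_le _ _) le_rfl).trans ?_)
    have e1 := hres q (by omega)
    have e2 := htail q (by omega) (S ∪ L)ᶜ
      (disjoint_compl_left.mono_right Finset.subset_union_left)
    push_cast
    linarith
  · have hvu : ‖restrict v (L \ S)‖ ≤ ‖restrict (u - s) (L \ S)‖ := by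
      refine norm_le_of_abs_le fun i => ?_
      by_cases hi : i ∈ L \ S
      · have hsi : s i = 0 := by
          by_contra hne
          exact (Finset.mem_sdiff.1 hi).2 (hs (mem_supp.2 hne))
        simp only [restrict_apply, hi, if_true, PiLp.sub_apply, hsi, sub_zero]
        exact abs_compressed_le hpoly i
      · simp [hi]
    have hc1 : (L \ S).card ≤ k := (Finset.card_le_card Finset.sdiff_subset).trans hL.1.le
    have hc := card_union_supp_sub_le (Ω := L \ S) (j := 2 * k) hs hx
      ((Finset.card_union_le _ _).trans (by omega))
    refine hvu.trans ((norm_restrict_heavyBall_sub_le A hα hβ s x' x ν hc1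
      (hc.trans (show 2 * k + k ≤ 3 * k by omega))).trans ?_)
    have e1 := mul_le_mul_of_nonneg_left (norm_restrict_le (x - s) (L \ S))
      (abs_nonneg (1 - α + β))
    have e2 := mul_le_mul_of_nonneg_left (norm_restrict_le (x' - s) (L \ S)) hβ
    linarith

/-- The error of the least squares projection onto a support set. -/
theorem norm_leastSquares_sub_le (A : Matrix (Fin m) (Fin n) ℝ) {k : ℕ}
    (h1 : ric A (2 * k) < 1) {s xs z : Vec n} (ν : Vec m)
    (hs : IsSparse k s) (hxs : IsSparse k xs)
    (hz : IsLeastSquares A (app A s + ν) (supp xs) z) :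
    ‖z - s‖ ≤ 1 / √(1 - ric A (2 * k) ^ 2) * ‖xs - s‖ +
      √(1 + ric A k) / (1 - ric A (2 * k)) * ‖ν‖ := by
  set δ := ric A (2 * k) with hδ
  have hδ0 : 0 ≤ δ := ric_nonneg A _
  set T := supp xs with hT
  set e := z - s with he
  set h := restrict e T with hh
  have hsupp : supp h ⊆ T := supp_restrict_subset _ _
  have horth : inner ℝ (app A e - ν) (app A h) = 0 := by
    have hmin : ∀ τ : ℝ, 0 ≤ 2 * τ * inner ℝ (app A e - ν) (app A h) + τ ^ 2 * ‖app A h‖ ^ 2 := by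
      intro τ
      have hmem : z + τ • h ∈ {x : Vec n | supp x ⊆ T} :=
        (supp_add_subset _ _).trans (Finset.union_subset hz.1 ((supp_smul_subset _ _).trans hsupp))
      have h2 := hz.2 hmem
      simp only [Set.mem_ofPred_eq] at h2
      have e1 : app A s + ν - app A z = -(app A e - ν) := by rw [he, app_sub]; abel
      have e2 : app A s + ν - app A (z + τ • h) = -((app A e - ν) + τ • app A h) := by
        rw [he, app_sub, app_add, app_smul]; abel
      rw [e1, e2, norm_neg, norm_neg, norm_add_sq_real, inner_smul_right, norm_smul, mul_pow,
        Real.norm_eq_abs, sq_abs] at h2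
      linarith
    set p := inner ℝ (app A e - ν) (app A h)
    set Q := ‖app A h‖ ^ 2
    have hQ : 0 ≤ Q := sq_nonneg _
    -- Near-optimal step length; `Q + 1` instead of `Q` avoids the case `Q = 0`.
    have h3 := hmin (-p / (Q + 1))
    have h4 : 2 * (-p / (Q + 1)) * p + (-p / (Q + 1)) ^ 2 * Q =
        -(p ^ 2 * (Q + 2)) / (Q + 1) ^ 2 := by field_simp; ring
    rw [h4, le_div_iff₀ (by positivity)] at h3
    have h5 : p ^ 2 * (Q + 2) = 0 := le_antisymm (by linarith) (by positivity)
    rcases mul_eq_zero.1 h5 with h6 | h6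
    · exact pow_eq_zero_iff (by norm_num) |>.1 h6
    · linarith
  have hcard : (supp h ∪ supp e).card ≤ 2 * k := by
    have : supp h ∪ supp e ⊆ T ∪ supp s :=
      Finset.union_subset (hsupp.trans Finset.subset_union_left)
        ((supp_sub_subset _ _).trans (Finset.union_subset_union hz.1 subset_rfl))
    refine (Finset.card_le_card this).trans ((Finset.card_union_le _ _).trans ?_)
    have a1 : T.card ≤ k := hxs
    have a2 : (supp s).card ≤ k := hs
    omega
  set g := √(1 + ric A k) * ‖ν‖ with hg
  have hg0 : 0 ≤ g := by positivity
  have hin : ‖h‖ ≤ δ * ‖e‖ + g := by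
    have i1 : inner ℝ h e = ‖h‖ ^ 2 := inner_restrict_self e T
    have i2 := inner_sub_inner_app_le A hcard
    rw [inner_sub_left, real_inner_comm (app A h) (app A e)] at horth
    have i3 := real_inner_le_norm ν (app A h)
    have i4 := mul_le_mul_of_nonneg_left
      (norm_app_le A (isSparse_restrict (k := k) e (Ω := T) hxs)) (norm_nonneg ν)
    rw [← hh] at i4
    rcases (norm_nonneg h).eq_or_lt with h0 | h0
    · rw [← h0]; positivity
    · refine le_of_mul_le_mul_left ?_ h0
      rw [hg]
      nlinarith
  set ρ := ‖xs - s‖ with hρ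
  -- Off `T` both `z` and `xs` vanish, so both errors equal `-s` there.
  have hout : ‖restrict e Tᶜ‖ ≤ ρ := by
    refine norm_le_of_abs_le fun i => ?_
    by_cases hi : i ∈ T
    · simp [hi]
    · have a1 : xs i = 0 := by simpa [hT] using hi
      have a2 : z i = 0 := by
        by_contra hne
        exact hi (hz.1 (mem_supp.2 hne))
      simp [hi, a1, he, a2]
  have hsplit : ‖e‖ ^ 2 = ‖h‖ ^ 2 + ‖restrict e Tᶜ‖ ^ 2 := by
    rw [hh, norm_restrict_sq, norm_restrict_sq, EuclideanSpace.real_norm_sq_eq,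
      Finset.sum_add_sum_compl]
  have hE : ‖e‖ ^ 2 ≤ (δ * ‖e‖ + g) ^ 2 + ρ ^ 2 := by
    rw [hsplit]
    gcongr
  have hρ0 : 0 ≤ ρ := norm_nonneg _
  have hz2 : 0 < 1 - δ ^ 2 := by nlinarith
  set ζ := √(1 - δ ^ 2) with hζ
  have hζ0 : 0 < ζ := Real.sqrt_pos.2 hz2
  have hζ2 : ζ ^ 2 = 1 - δ ^ 2 := Real.sq_sqrt hz2.le
  have hfin : ζ ^ 2 * ‖e‖ ≤ ζ * ρ + (1 + δ) * g := by
    -- Completing the square in `hE`, using `ζ² = 1 - δ²`; the exact right side is `ζ²ρ² + g²`.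
    have : (ζ ^ 2 * ‖e‖ - δ * g) ^ 2 ≤ (ζ * ρ + g) ^ 2 := by
      have h1 : ζ ^ 2 * ‖e‖ ^ 2 ≤ 2 * δ * g * ‖e‖ + g ^ 2 + ρ ^ 2 := by rw [hζ2]; linarith
      have h2 := mul_le_mul_of_nonneg_left h1 (sq_nonneg ζ)
      have h3 : 0 ≤ 2 * ζ * ρ * g := by positivity
      nlinarith
    have := abs_le_of_sq_le_sq' this (by positivity) |>.2
    linarith
  have h1δ : 0 < 1 - δ := by linarith
  have hfac : ζ ^ 2 = (1 - δ) * (1 + δ) := by rw [hζ2]; ring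
  have : ‖e‖ ≤ (ζ * ρ + (1 + δ) * g) / ζ ^ 2 := by
    rw [le_div_iff₀ (by positivity)]; linarith
  refine this.trans (le_of_eq ?_)
  rw [add_div]
  congr 1
  · field_simp
  · rw [hfac, hg]; field_simp

/-! ### The constants -/

theorem two_le_sigma {n k : ℕ} (hk : 1 ≤ k) (hn : 3 * k < n) : 2 ≤ sigma n k := by
  have hk' : (0 : ℝ) < k := by exact_mod_cast hk
  have hn' : (3 * k : ℝ) < n := by exact_mod_cast hn
  refine Nat.lt_ceil.2 ?_
  rw [lt_div_iff₀ hk']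
  push_cast
  linarith

/-- For `q < 8` this is the arithmetic-geometric mean inequality for `2/√q` and `√q/4`. -/
theorem sqrt_two_le_xi {q : ℕ} (hq : 2 ≤ q) : √2 ≤ xi q := by
  rw [xi, if_neg (by omega)]
  split_ifs
  · have hq0 : (0 : ℝ) < √(q : ℝ) := Real.sqrt_pos.2 (by exact_mod_cast (by omega : 0 < q))
    have h2 : √(2 : ℝ) ^ 2 = 2 := Real.sq_sqrt (by norm_num)
    rw [div_add_div _ _ hq0.ne' (by norm_num), le_div_iff₀ (by positivity)]
    nlinarith [sq_nonneg (√(q : ℝ) - 2 * √2)]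
  · exact le_rfl

theorem xi_le_two {q : ℕ} (hq : 2 ≤ q) : xi q ≤ 2 := by
  have h2 : √(2 : ℝ) ^ 2 = 2 := Real.sq_sqrt (by norm_num)
  rw [xi, if_neg (by omega)]
  split_ifs with h8
  · have hqr : (2 : ℝ) ≤ q := by exact_mod_cast hq
    have hq8 : (q : ℝ) ≤ 8 := by exact_mod_cast h8.le
    have hs : √(q : ℝ) ^ 2 = q := Real.sq_sqrt (by linarith)
    have hq0 : (0 : ℝ) < √(q : ℝ) := Real.sqrt_pos.2 (by linarith)
    have hl : (1.2 : ℝ) ≤ √(q : ℝ) := Real.le_sqrt' (by norm_num) |>.2 (by linarith)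
    have hu : √(q : ℝ) ≤ 3 := Real.sqrt_le_iff.2 ⟨by norm_num, by linarith⟩
    rw [div_add_div _ _ hq0.ne' (by norm_num), div_le_iff₀ (by positivity)]
    nlinarith
  · nlinarith [Real.sqrt_nonneg 2]

/-! Scalar comparisons, with `P = ω - 1`, `e = δ_{2k}` and `d = δ_{3k}`. -/

section Scalar

variable {P ξ τ a d e : ℝ}

/-- After cancellation this is `ξe ≤ 2d`. It says `(ξ(P+1)+1)/(ξP+1) ≤ (2(P+1)d+e)/(2Pd+e)`; the
ratio `c_σ/c_{1,σ}` is a mediant of these two fractions and so lies between them. -/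
theorem xi_mul_le_aux (hξ : ξ ≤ 2) (he : 0 < e) (hed : e ≤ d) :
    ξ * (2 * P * d + e) ≤ 2 * d * (ξ * P + 1) := by
  nlinarith

theorem div_c_lower (hP : 0 ≤ P) (hξ0 : 0 ≤ ξ) (hξ : ξ ≤ 2) (hτ : 0 ≤ τ) (ha : 0 < a)
    (he : 0 < e) (hed : e ≤ d) :
    ξ * (P + 1) + 1 ≤ (ξ * P + 1) * ((((P + 1) * ξ + 1) * τ + a * (2 * (P + 1) * d + e)) /
      ((ξ * P + 1) * τ + a * (2 * P * d + e))) := by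
  have hd : 0 < d := he.trans_le hed
  have hc : 0 < (ξ * P + 1) * τ + a * (2 * P * d + e) := by positivity
  have h := mul_le_mul_of_nonneg_left (xi_mul_le_aux (P := P) hξ he hed) ha.le
  rw [← mul_div_assoc, le_div_iff₀ hc]
  nlinarith

theorem div_c_upper (hP : 0 ≤ P) (hξ0 : 0 ≤ ξ) (hξ : ξ ≤ 2) (hτ : 0 ≤ τ) (ha : 0 < a)
    (he : 0 < e) (hed : e ≤ d) :
    (((P + 1) * ξ + 1) * τ + a * (2 * (P + 1) * d + e)) /
      ((ξ * P + 1) * τ + a * (2 * P * d + e)) ≤ (2 * (P + 1) * d + e) / (2 * P * d + e) := by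
  have hd : 0 < d := he.trans_le hed
  have hc : 0 < (ξ * P + 1) * τ + a * (2 * P * d + e) := by positivity
  have h := mul_le_mul_of_nonneg_left (xi_mul_le_aux (P := P) hξ he hed) hτ
  rw [div_le_div_iff₀ hc (by positivity)]
  nlinarith

/-- The product is `2d/(2Pd+e) * (1 + c₁/(c - c₁))`. The first summand is at least `2/(2P+1)`
because `e ≤ d`, the second at least `1` by `xi_mul_le_aux`. -/
theorem noise_ratio_lower (hP : 0 ≤ P) (hξ0 : 0 ≤ ξ) (hξ : ξ ≤ 2) (hτ : 0 ≤ τ) (ha : 0 < a)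
    (he : 0 < e) (hed : e ≤ d) :
    (2 * P + 3) / (2 * P + 1) ≤ 2 * d / (2 * P * d + e) *
      ((((P + 1) * ξ + 1) * τ + a * (2 * (P + 1) * d + e)) /
        ((((P + 1) * ξ + 1) * τ + a * (2 * (P + 1) * d + e)) -
          ((ξ * P + 1) * τ + a * (2 * P * d + e)))) := by
  have hd : 0 < d := he.trans_le hed
  have hdiff : (((P + 1) * ξ + 1) * τ + a * (2 * (P + 1) * d + e)) -
          ((ξ * P + 1) * τ + a * (2 * P * d + e)) = ξ * τ + 2 * a * d := by ring
  have h1 : (2 * P * d + e) * (ξ * τ + 2 * a * d) ≤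
      2 * d * ((ξ * P + 1) * τ + a * (2 * P * d + e)) := by
    have h := mul_le_mul_of_nonneg_left (xi_mul_le_aux (P := P) hξ he hed) hτ
    nlinarith
  have hD : 0 < ξ * τ + 2 * a * d := by positivity
  have hg : 0 < 2 * P * d + e := by positivity
  rw [hdiff, div_mul_div_comm, div_le_div_iff₀ (by positivity) (by positivity)]
  have h2 : (2 * P + 3) * ((2 * P * d + e) * (ξ * τ + 2 * a * d)) ≤
      (2 * P + 1) * ((2 * P * d + e) * (ξ * τ + 2 * a * d)) +
        (2 * P + 1) * (2 * d) * (ξ * τ + 2 * a * d) := by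
    have : 2 * (2 * P * d + e) ≤ (2 * P + 1) * (2 * d) := by nlinarith
    have := mul_le_mul_of_nonneg_right this hD.le
    nlinarith
  have h3 := mul_le_mul_of_nonneg_left h1 (by linarith : (0 : ℝ) ≤ 2 * P + 1)
  refine h2.trans ?_
  have h4 : 2 * d * (((P + 1) * ξ + 1) * τ + a * (2 * (P + 1) * d + e)) * (2 * P + 1) =
      (2 * P + 1) * (2 * d * ((ξ * P + 1) * τ + a * (2 * P * d + e))) +
        (2 * P + 1) * (2 * d) * (ξ * τ + 2 * a * d) := by ring
  rw [h4]
  linarith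

end Scalar

/-! ### Second-order linear recursions -/

/-- As `θ(θ - b) = c`, the combination `a (p+1) + (θ - b) * a p` contracts by `θ` up to `g`, and `g
/ (1 - θ)` is the fixed point of `t ↦ θt + g`. -/
theorem recursion_bound {b c g θ : ℝ} (hθ : θ ^ 2 = b * θ + c) (hθ0 : 0 ≤ θ)
    (hbθ : b ≤ θ) (hθ1 : θ < 1) {a : ℕ → ℝ} (ha : ∀ p, 0 ≤ a p)
    (h : ∀ p, a (p + 2) ≤ b * a (p + 1) + c * a p + g) (hg : 0 ≤ g) (p : ℕ) :
    a (p + 1) ≤ θ ^ p * (a 1 + (θ - b) * a 0) + g / (1 - θ) := by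
  have h1 : 0 < 1 - θ := by linarith
  have key : ∀ p, a (p + 1) + (θ - b) * a p ≤ θ ^ p * (a 1 + (θ - b) * a 0) + g / (1 - θ) := by
    intro p
    induction p with
    | zero => simpa using div_nonneg hg h1.le
    | succ p ih =>
      have e1 := mul_le_mul_of_nonneg_left ih hθ0
      have e2 : g / (1 - θ) = θ * (g / (1 - θ)) + g := by field_simp; ring
      have e3 := h p
      have e4 : θ * (θ - b) = c := by linarith [hθ]
      have e5 : θ * ((θ - b) * a p) = c * a p := by rw [← e4]; ring
      rw [pow_succ, e2]
      nlinarith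
  linarith [key p, mul_nonneg (sub_nonneg.2 hbθ) (ha p)]

theorem quadratic_root_facts {b c : ℝ} (hb : 0 ≤ b) (hc : 0 ≤ c) (hbc : b + c < 1) :
    ((b + √(b ^ 2 + 4 * c)) / 2) ^ 2 = b * ((b + √(b ^ 2 + 4 * c)) / 2) + c ∧
      0 ≤ (b + √(b ^ 2 + 4 * c)) / 2 ∧ b ≤ (b + √(b ^ 2 + 4 * c)) / 2 ∧
      (b + √(b ^ 2 + 4 * c)) / 2 < 1 := by
  have hs : √(b ^ 2 + 4 * c) ^ 2 = b ^ 2 + 4 * c := Real.sq_sqrt (by positivity)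
  have h0 := Real.sqrt_nonneg (b ^ 2 + 4 * c)
  have hle : b ≤ √(b ^ 2 + 4 * c) := Real.le_sqrt_of_sq_le (by linarith)
  have hlt : √(b ^ 2 + 4 * c) < 2 - b := (Real.sqrt_lt' (by linarith)).2 (by nlinarith)
  refine ⟨by nlinarith, by positivity, by linarith, by linarith⟩

/-! ### The thresholds on the restricted isometry constant -/

theorem strictMonoOn_G (ω : ℕ) : StrictMonoOn (G ω) (Set.Ico 0 1) := by
  intro x hx y hy hxy
  have h1 : (1 + x) / (1 - x) ≤ (1 + y) / (1 - y) := by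
    rw [div_le_div_iff₀ (by linarith [hx.2]) (by linarith [hy.2])]
    nlinarith
  have h2 := Real.sqrt_le_sqrt h1
  have h3 := hx.1
  have h4 : (2 * ω + 1 : ℝ) * x ≤ (2 * ω + 1) * y := by gcongr
  have h5 : 0 ≤ (2 * ω + 1 : ℝ) * x := by positivity
  have h6 := mul_le_mul h4 h2 (Real.sqrt_nonneg _) (h5.trans h4)
  unfold G
  linarith

/-- The interval avoids the singularity at `1` and already contains the crossing, by
`one_lt_G_half`. -/
theorem continuousOn_G (ω : ℕ) : ContinuousOn (G ω) (Set.Icc 0 (1 / 2)) := by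
  unfold G
  refine ((continuousOn_const.mul continuousOn_id).mul
    (ContinuousOn.sqrt (ContinuousOn.div (by fun_prop) (by fun_prop) fun x hx => ?_))).add
    continuousOn_id
  have := hx.2
  intro h
  linarith

theorem G_zero (ω : ℕ) : G ω 0 = 0 := by simp [G]

theorem one_lt_G_half {ω : ℕ} (hω : 1 ≤ ω) : 1 < G ω (1 / 2) := by
  have h : (1 : ℝ) ≤ √((1 + 1 / 2) / (1 - 1 / 2)) := Real.one_le_sqrt.2 (by norm_num)
  have hω' : (1 : ℝ) ≤ ω := by exact_mod_cast hω
  unfold G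
  nlinarith

theorem existsUnique_root {f : ℝ → ℝ} (hmono : StrictMonoOn f (Set.Ico 0 1))
    (hcont : ContinuousOn f (Set.Icc 0 (1 / 2))) (h0 : f 0 < 1) (h1 : 1 ≤ f (1 / 2)) :
    ∃! γ : ℝ, γ ∈ Set.Ioo (0 : ℝ) 1 ∧ f γ = 1 := by
  obtain ⟨γ, hγ, hf⟩ := intermediate_value_Icc (by norm_num) hcont ⟨h0.le, h1⟩
  have hγ0 : γ ≠ 0 := fun h => by rw [h] at hf; linarith
  refine ⟨γ, ⟨⟨lt_of_le_of_ne hγ.1 hγ0.symm, by linarith [hγ.2]⟩, hf⟩, ?_⟩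
  rintro γ' ⟨hγ', hf'⟩
  exact hmono.injOn ⟨hγ'.1.le, hγ'.2⟩ ⟨hγ.1, by linarith [hγ.2]⟩ (hf'.trans hf.symm)

theorem existsUnique_isGammaStar {ω : ℕ} (hω : 1 ≤ ω) : ∃! γ : ℝ, IsGammaStar ω γ :=
  existsUnique_root (strictMonoOn_G ω) (continuousOn_G ω) (by rw [G_zero]; norm_num)
    (one_lt_G_half hω).le

theorem existsUnique_isGammaSharp {ω : ℕ} (hω : 1 ≤ ω) : ∃! γ : ℝ, IsGammaSharp ω γ := by
  refine existsUnique_root (f := fun γ => 1 / √(1 - γ ^ 2) * G ω γ) ?_ ?_ ?_ ?_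
  · intro x hx y hy hxy
    have hG := strictMonoOn_G ω hx hy hxy
    have hGx : 0 ≤ G ω x := by
      have := (strictMonoOn_G ω).monotoneOn ⟨le_rfl, one_pos⟩ hx hx.1
      rwa [G_zero] at this
    have hx0 := hx.1
    have hy1 := hy.2
    have hs : 0 < √(1 - y ^ 2) := Real.sqrt_pos.2 (by nlinarith)
    have hle : 1 / √(1 - x ^ 2) ≤ 1 / √(1 - y ^ 2) :=
      one_div_le_one_div_of_le hs (Real.sqrt_le_sqrt (by nlinarith))
    exact mul_lt_mul' hle hG hGx (by positivity)
  · refine ContinuousOn.mul (ContinuousOn.div (by fun_prop) (by fun_prop) fun x hx => ?_)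
      (continuousOn_G ω)
    exact (Real.sqrt_pos.2 (by nlinarith [hx.1, hx.2])).ne'
  · simp [G_zero]
  · have h1 := (one_lt_G_half hω).le
    have hs : 0 < √(1 - (1 / 2 : ℝ) ^ 2) := Real.sqrt_pos.2 (by norm_num)
    have h2 : (1 : ℝ) ≤ 1 / √(1 - (1 / 2 : ℝ) ^ 2) := by
      rw [le_div_iff₀ hs, one_mul]
      exact Real.sqrt_le_one.2 (by norm_num)
    exact one_le_mul_of_one_le_of_one_le h2 h1

/-! ### Comparison with the stated constants -/

section Comparison

variable (A : Matrix (Fin m) (Fin n) ℝ) {k ω : ℕ} {α β : ℝ}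

theorem t_nonneg (k : ℕ) : 0 ≤ t A k := by unfold t; positivity

theorem xi_sigma_bounds (hk : 1 ≤ k) (hn : 3 * k < n) :
    √2 ≤ xi (sigma n k) ∧ xi (sigma n k) ≤ 2 :=
  ⟨sqrt_two_le_xi (two_le_sigma hk hn), xi_le_two (two_le_sigma hk hn)⟩

/-- Compared coefficient by coefficient: `√2 ≤ ξ` suffices for `X`, `div_c_lower` handles `X'`, and
`noise_ratio_lower` handles `N`. -/
theorem sharp_bound_le (hmn : m < n) (hk : 1 ≤ k) (hω : 1 ≤ ω) (hn : 3 * k < n) (hα : 0 < α)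
    (hβ : 0 ≤ β) (h1 : ric A (2 * k) < 1) {X X' N : ℝ} (hX : 0 ≤ X) (hX' : 0 ≤ X')
    (hN : 0 ≤ N) :
    (2 * N + √(1 + ric A k) * (
        (|1 - α + β| + α * ric A (2 * k)) * X + β * X' + α * √(1 + ric A k) * N +
        ω * ((√2 * |1 - α + β| + 2 * α * ric A (3 * k)) * X + β * √2 * X' +
          2 * α * √(1 + ric A k) * N))) / √(1 - ric A (2 * k)) +
      ((|1 - α + β| + α * ric A (3 * k)) * X + β * X' + α * √(1 + ric A k) * N) ≤
    b1 A k ω α β * X + b2 A k ω α β * X' + b3 A k ω α β * N := by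
  obtain ⟨hξl, hξ⟩ := xi_sigma_bounds (n := n) hk hn
  have he : 0 < ric A (2 * k) := ric_pos A hmn (by omega)
  have hed : ric A (2 * k) ≤ ric A (3 * k) := ric_mono A (by omega)
  have hδk := ric_nonneg A k
  obtain ⟨q, rfl⟩ : ∃ q, ω = q + 1 := ⟨ω - 1, by omega⟩
  have hP : (0 : ℝ) ≤ q := Nat.cast_nonneg q
  set ξ := xi (sigma n k) with hξdef
  have hξ0 : 0 ≤ ξ := (Real.sqrt_nonneg 2).trans hξl
  have hτ : 0 ≤ |1 - α + β| := abs_nonneg _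
  have k1 := div_c_lower hP hξ0 hξ hτ hα he hed
  have k2 := noise_ratio_lower hP hξ0 hξ hτ hα he hed
  have habs : |1 + β - α| = |1 - α + β| := by congr 1; ring
  unfold b1 b2 b3 t c c1
  rw [habs]
  simp only [← hξdef]
  push_cast
  simp only [add_sub_cancel_right]
  set τ := |1 - α + β|
  set e := ric A (2 * k)
  set d := ric A (3 * k)
  set C := (((q : ℝ) + 1) * ξ + 1) * τ + α * (2 * ((q : ℝ) + 1) * d + e)
  set C1 := (ξ * q + 1) * τ + α * (2 * q * d + e)
  have hs1 : 0 < √(1 - e) := Real.sqrt_pos.2 (by linarith)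
  have hsq : √(1 + ric A k) ^ 2 = 1 + ric A k := Real.sq_sqrt (by linarith)
  set r := √(1 + ric A k)
  have hr : 0 ≤ r := Real.sqrt_nonneg _
  set T := √(1 - e)
  have g1 : r / T * ((τ + α * e) + (q + 1) * (√2 * τ + 2 * α * d)) ≤ r / T * C := by
    refine mul_le_mul_of_nonneg_left ?_ (by positivity)
    have := mul_le_mul_of_nonneg_right hξl (mul_nonneg (by positivity : (0 : ℝ) ≤ q + 1) hτ)
    simp only [C]
    linarith
  have g2 : r / T * β * (1 + (q + 1) * √2) ≤ r / T * β * ((ξ * q + 1) * (C / C1)) := by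
    refine mul_le_mul_of_nonneg_left (le_trans ?_ k1) (by positivity)
    have := mul_le_mul_of_nonneg_right hξl (by positivity : (0 : ℝ) ≤ q + 1)
    linarith
  -- The derived noise term carries `2ω + 1` where `b₃` has `2ω - 1`; the extra ratio in `b₃` is at
  -- least `(2ω+1)/(2ω-1)`, which makes up for it.
  have g3 : (2 + α * (1 + ric A k) * (2 * q + 3)) / T ≤
      (α * (2 * (q + 1) - 1) * (1 + ric A k) + 2) / T * (2 * d / (2 * q * d + e) *
        (C / (C - C1))) := by
    have h3 : 0 < (α * (2 * (q + 1) - 1) * (1 + ric A k) + 2) / T := by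
      have : (0 : ℝ) < 2 * (q + 1) - 1 := by linarith
      positivity
    refine le_trans ?_ (mul_le_mul_of_nonneg_left k2 h3.le)
    rw [div_mul_div_comm, div_le_div_iff₀ hs1 (by positivity)]
    have h4 : (2 + α * (1 + ric A k) * (2 * q + 3)) * (2 * q + 1) ≤
        (α * (2 * (q + 1) - 1) * (1 + ric A k) + 2) * (2 * q + 3) := by linarith
    have := mul_le_mul_of_nonneg_right h4 hs1.le
    linarith
  have f1 := mul_le_mul_of_nonneg_right g1 hX
  have f2 := mul_le_mul_of_nonneg_right g2 hX'
  have f3 := mul_le_mul_of_nonneg_right g3 hN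
  have split : (2 * N + r * ((τ + α * e) * X + β * X' + α * r * N +
        ((q : ℝ) + 1) * ((√2 * τ + 2 * α * d) * X + β * √2 * X' + 2 * α * r * N))) / T =
      r / T * ((τ + α * e) + (q + 1) * (√2 * τ + 2 * α * d)) * X +
      r / T * β * (1 + (q + 1) * √2) * X' +
      (2 + α * r ^ 2 * (2 * q + 3)) / T * N := by
    field_simp
    ring
  rw [split, hsq]
  linarith

theorem b1_nonneg (hk : 1 ≤ k) (hn : 3 * k < n) (hα : 0 ≤ α) : 0 ≤ b1 A k ω α β := by
  have hξ : 0 ≤ xi (sigma n k) := (Real.sqrt_nonneg 2).trans (xi_sigma_bounds (n := n) hk hn).1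
  have := ric_nonneg A (2 * k)
  have := ric_nonneg A (3 * k)
  have := t_nonneg A k
  unfold b1 c
  positivity

theorem b2_nonneg (hk : 1 ≤ k) (hω : 1 ≤ ω) (hn : 3 * k < n) (hα : 0 ≤ α) (hβ : 0 ≤ β) :
    0 ≤ b2 A k ω α β := by
  have hξ : 0 ≤ xi (sigma n k) := (Real.sqrt_nonneg 2).trans (xi_sigma_bounds (n := n) hk hn).1
  have := ric_nonneg A (2 * k)
  have := ric_nonneg A (3 * k)
  have := t_nonneg A k
  have hP : (0 : ℝ) ≤ (ω : ℝ) - 1 := sub_nonneg.2 (by exact_mod_cast hω)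
  unfold b2 c c1
  positivity

theorem b3_nonneg (hk : 1 ≤ k) (hω : 1 ≤ ω) (hn : 3 * k < n) (hα : 0 ≤ α) :
    0 ≤ b3 A k ω α β := by
  have hξ : 0 ≤ xi (sigma n k) := (Real.sqrt_nonneg 2).trans (xi_sigma_bounds (n := n) hk hn).1
  have := ric_nonneg A k
  have := ric_nonneg A (2 * k)
  have := ric_nonneg A (3 * k)
  have hP : (0 : ℝ) ≤ (ω : ℝ) - 1 := sub_nonneg.2 (by exact_mod_cast hω)
  have hP' : (0 : ℝ) ≤ 2 * (ω : ℝ) - 1 := by linarith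
  have hc : 0 ≤ c A k ω α β - c1 A k ω α β := by
    have : c A k ω α β - c1 A k ω α β =
        xi (sigma n k) * |1 - α + β| + 2 * α * ric A (3 * k) := by unfold c c1; ring
    rw [this]
    positivity
  have hc' : 0 ≤ c A k ω α β := by unfold c; positivity
  unfold b3
  positivity

theorem d_nonneg (hk : 1 ≤ k) (hω : 1 ≤ ω) (hn : 3 * k < n) :
    0 ≤ d0 A k ω ∧ 0 ≤ d1 A k ω ∧ 0 ≤ d2 A k ω := by
  have hξ : 0 ≤ xi (sigma n k) := (Real.sqrt_nonneg 2).trans (xi_sigma_bounds (n := n) hk hn).1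
  have := ric_nonneg A (2 * k)
  have := ric_nonneg A (3 * k)
  have := t_nonneg A k
  have hP : (0 : ℝ) ≤ (ω : ℝ) - 1 := sub_nonneg.2 (by exact_mod_cast hω)
  refine ⟨?_, ?_, ?_⟩
  · unfold d0; positivity
  · unfold d1; positivity
  · unfold d2; positivity

/-- `div_c_upper` bounds `c_σ/c_{1,σ}` by the ratio appearing in `d₂`, which is free of `α` and `β`.
-/
theorem b1_add_b2_le (hmn : m < n) (hk : 1 ≤ k) (hω : 1 ≤ ω) (hn : 3 * k < n) (hα : 0 < α)
    (hβ : 0 ≤ β) :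
    b1 A k ω α β + b2 A k ω α β ≤
      (d0 A k ω + 1) * |1 - α + β| + α * d1 A k ω + β * (d2 A k ω + 1) := by
  obtain ⟨hξl, hξ⟩ := xi_sigma_bounds (n := n) hk hn
  have he : 0 < ric A (2 * k) := ric_pos A hmn (by omega)
  have hed : ric A (2 * k) ≤ ric A (3 * k) := ric_mono A (by omega)
  have hP : (0 : ℝ) ≤ (ω : ℝ) - 1 := sub_nonneg.2 (by exact_mod_cast hω)
  have hξ0 : 0 ≤ xi (sigma n k) := (Real.sqrt_nonneg 2).trans hξl
  have k1 := div_c_upper hP hξ0 hξ (abs_nonneg (1 - α + β)) hα he hed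
  rw [sub_add_cancel] at k1
  have ht := t_nonneg A k
  have k2 := mul_le_mul_of_nonneg_left k1
    (by positivity : 0 ≤ β * t A k * (xi (sigma n k) * ((ω : ℝ) - 1) + 1))
  have habs : |1 + β - α| = |1 - α + β| := by congr 1; ring
  unfold b1 b2 d0 d1 d2 c c1
  rw [habs]
  linarith

/-- The parameter ranges of both algorithms, with `ζ = 1` or `ζ = z_k`. -/
theorem range_consequences (hmn : m < n) (hk : 1 ≤ k) (hω : 1 ≤ ω) (hn : 3 * k < n)
    {ζ : ℝ} (hζ : ζ ≤ 1) (hβ : 0 ≤ β)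
    (hβ1 : β < (ζ - d1 A k ω) / (1 + d1 A k ω + d2 A k ω))
    (hα1 : ((d0 A k ω + d2 A k ω + 2) * β + d0 A k ω + 1 - ζ) / (d0 A k ω - d1 A k ω + 1) < α)
    (hα2 : α < (d0 A k ω + 1 + ζ - (d2 A k ω - d0 A k ω) * β) / (d0 A k ω + d1 A k ω + 1)) :
    0 < α ∧ b1 A k ω α β + b2 A k ω α β < ζ := by
  obtain ⟨h0, h1, h2⟩ := d_nonneg A (ω := ω) hk hω hn
  have hpos : 0 < 1 + d1 A k ω + d2 A k ω := by linarith
  have hd1 : d1 A k ω < ζ := by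
    have := (div_pos_iff_of_pos_right hpos).1 (hβ.trans_lt hβ1)
    linarith
  have hden : 0 < d0 A k ω - d1 A k ω + 1 := by linarith
  have hα : 0 < α := by
    refine lt_of_le_of_lt (div_nonneg ?_ hden.le) hα1
    have : 0 ≤ (d0 A k ω + d2 A k ω + 2) * β := by positivity
    linarith
  refine ⟨hα, (b1_add_b2_le A hmn hk hω hn hα hβ).trans_lt ?_⟩
  rw [div_lt_iff₀ hden] at hα1
  rw [lt_div_iff₀ (by linarith)] at hα2
  -- The two signs of `1 - α + β` correspond exactly to the lower and the upper bound on `α`.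
  rcases abs_cases (1 - α + β) with ⟨h, _⟩ | ⟨h, _⟩ <;> rw [h] <;> linarith

end Comparison

/-! ### Sparsity of the iterates and the error bounds -/

theorem isSparse_of_isHardThresholding {k : ℕ} {x xs : Vec n} (h : IsHardThresholding k x xs) :
    IsSparse k xs := by
  obtain ⟨L, hL, rfl⟩ := h
  exact isSparse_restrict x hL.1.le

theorem isSparse_of_isSharp {A : Matrix (Fin m) (Fin n) ℝ} {y : Vec m} {k ω : ℕ} {α β : ℝ}
    {x' x xs : Vec n} (h : IsSharp A y k ω α β x' x xs) : IsSparse k xs := by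
  obtain ⟨w, -, hL⟩ := h
  exact isSparse_of_isHardThresholding hL

end HeavyBall

open HeavyBall in
theorem hbrot_error_bound {m n k ω : ℕ} (hk : 1 ≤ k) (hω : 1 ≤ ω) (hmn : m < n) (hn : 3 * k < n)
    (A : Matrix (Fin m) (Fin n) ℝ) {α β : ℝ} {s : Vec n} {S : Finset (Fin n)} (hs : supp s ⊆ S)
    (hS : S.card = k) (ν : Vec m) (h2k : ric A (2 * k) < 1) (hR : RangeHBROT A k ω α β) :
    theta1 A k ω α β < 1 ∧
      ∀ X : ℕ → Vec n, IsSparse k (X 1) → IsHBROT A (app A s + ν) k ω α β X → ∀ p : ℕ,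
        ‖X (p + 1) - s‖ ≤ theta1 A k ω α β ^ p *
            (‖X 1 - s‖ + (theta1 A k ω α β - b1 A k ω α β) * ‖X 0 - s‖) +
          b3 A k ω α β / (1 - theta1 A k ω α β) * ‖ν‖ := by
  obtain ⟨⟨hβ, hβ1⟩, hα1, hα2⟩ := hR
  obtain ⟨hα, hb⟩ := range_consequences A hmn hk hω hn le_rfl hβ hβ1
    (by convert hα1 using 2; ring) (by convert hα2 using 2; ring)
  have hb2 := b2_nonneg A hk hω hn hα.le hβ
  obtain ⟨hθ, hθ0, hbθ, hθ1⟩ := quadratic_root_facts (b1_nonneg A hk hn hα.le) hb2 hb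
  refine ⟨hθ1, fun X hX1 hX p => ?_⟩
  have hsparse : ∀ p, IsSparse k (X (p + 1)) := by
    rintro (_ | p)
    · exact hX1
    · exact isSparse_of_isSharp (hX p)
  have := recursion_bound (a := fun p => ‖X p - s‖) (g := b3 A k ω α β * ‖ν‖) hθ hθ0 hbθ hθ1
    (fun p => norm_nonneg _) (fun p => ?_)
    (mul_nonneg (b3_nonneg A hk hω hn hα.le) (norm_nonneg _)) p
  · rw [div_mul_eq_mul_div]; exact this
  · exact (norm_sharp_sub_le A hk hω hα.le hβ h2k ν hs hS (hsparse p) (hX p)).trans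
      (sharp_bound_le A hmn hk hω hn hα hβ h2k (norm_nonneg _) (norm_nonneg _) (norm_nonneg _))

open HeavyBall in
theorem hbrotp_error_bound {m n k ω : ℕ} (hk : 1 ≤ k) (hω : 1 ≤ ω) (hmn : m < n)
    (hn : 3 * k < n) (A : Matrix (Fin m) (Fin n) ℝ) {α β : ℝ} {s : Vec n} {S : Finset (Fin n)}
    (hs : supp s ⊆ S) (hS : S.card = k) (ν : Vec m) (h2k : ric A (2 * k) < 1)
    (hR : RangeHBROTP A k ω α β) :
    theta2 A k ω α β < 1 ∧
      ∀ X : ℕ → Vec n, IsSparse k (X 1) → IsHBROTP A (app A s + ν) k ω α β X → ∀ p : ℕ,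
        ‖X (p + 1) - s‖ ≤ theta2 A k ω α β ^ p *
            (‖X 1 - s‖ + (theta2 A k ω α β - b1 A k ω α β / z A k) * ‖X 0 - s‖) +
          1 / (1 - theta2 A k ω α β) *
            (b3 A k ω α β / z A k + √(1 + ric A k) / (1 - ric A (2 * k))) * ‖ν‖ := by
  obtain ⟨⟨hβ, hβ1⟩, hα1, hα2⟩ := hR
  have hδ := ric_nonneg A (2 * k)
  have hz : 0 < z A k := Real.sqrt_pos.2 (by nlinarith)
  have hz1 : z A k ≤ 1 := Real.sqrt_le_one.2 (by nlinarith)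
  obtain ⟨hα, hb⟩ := range_consequences A hmn hk hω hn hz1 hβ hβ1 hα1 hα2
  have hb1 := b1_nonneg A (ω := ω) (β := β) hk hn hα.le
  have hb2 := b2_nonneg A hk hω hn hα.le hβ
  have hb3 := b3_nonneg A (β := β) hk hω hn hα.le
  have hbz : b1 A k ω α β / z A k + b2 A k ω α β / z A k < 1 := by
    rw [← add_div, div_lt_one hz]; exact hb
  -- `θ₂` is the nonnegative root of `θ² = (b₁/z_k)θ + b₂/z_k`, so the recursion is run with the
  -- coefficients divided by `z_k`.
  have hθeq : theta2 A k ω α β = (b1 A k ω α β / z A k +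
      √((b1 A k ω α β / z A k) ^ 2 + 4 * (b2 A k ω α β / z A k))) / 2 := by
    have : (b1 A k ω α β / z A k) ^ 2 + 4 * (b2 A k ω α β / z A k) =
        (b1 A k ω α β ^ 2 + 4 * b2 A k ω α β * z A k) / z A k ^ 2 := by field_simp
    rw [this, Real.sqrt_div' _ (sq_nonneg _), Real.sqrt_sq hz.le, theta2]
    field_simp
  obtain ⟨hθ, hθ0, hbθ, hθ1⟩ :=
    quadratic_root_facts (div_nonneg hb1 hz.le) (div_nonneg hb2 hz.le) hbz
  rw [← hθeq] at hθ hθ0 hbθ hθ1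
  refine ⟨hθ1, fun X hX1 hX p => ?_⟩
  have hsparse : ∀ p, IsSparse k (X (p + 1)) := by
    rintro (_ | p)
    · exact hX1
    · obtain ⟨xs, h1, h2⟩ := hX p
      exact (Finset.card_le_card h2.1).trans (isSparse_of_isSharp h1)
  have hδ1 : 0 ≤ 1 - ric A (2 * k) := by linarith
  have := recursion_bound (a := fun p => ‖X p - s‖)
    (g := (b3 A k ω α β / z A k + √(1 + ric A k) / (1 - ric A (2 * k))) * ‖ν‖) hθ hθ0 hbθ hθ1
    (fun p => norm_nonneg _) (fun p => ?_) (by positivity) p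
  · convert this using 2
    ring
  · obtain ⟨xs, h1, h2⟩ := hX p
    have e1 := norm_leastSquares_sub_le A h2k ν ((Finset.card_le_card hs).trans hS.le)
      (isSparse_of_isSharp h1) h2
    have e2 := (norm_sharp_sub_le A hk hω hα.le hβ h2k ν hs hS (hsparse p) h1).trans
      (sharp_bound_le A hmn hk hω hn hα hβ h2k (norm_nonneg _) (norm_nonneg _) (norm_nonneg _))
    have e3 := mul_le_mul_of_nonneg_left e2 (one_div_pos.2 hz).le
    refine (e1.trans (add_le_add e3 le_rfl)).trans (le_of_eq ?_)
    ring

theorem mainTheorem2 (m n k ω : ℕ) (hk : 1 ≤ k) (hω : 1 ≤ ω) (hmn : m < n) (hn : 3 * k < n)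
    (A : Matrix (Fin m) (Fin n) ℝ) (α β : ℝ)
    (x : HeavyBall.Vec n) (ν y : HeavyBall.Vec m) (hy : y = HeavyBall.app A x + ν)
    (S : Finset (Fin n)) (hS : HeavyBall.IsLargest k x S) :
    (∃! γ : ℝ, HeavyBall.IsGammaStar ω γ) ∧
    (∃! γ : ℝ, HeavyBall.IsGammaSharp ω γ) ∧
    (∀ γ : ℝ, HeavyBall.IsGammaStar ω γ → HeavyBall.ric A (3 * k) < γ →
      HeavyBall.RangeHBROT A k ω α β →
      HeavyBall.theta1 A k ω α β < 1 ∧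
      ∀ X : ℕ → HeavyBall.Vec n, HeavyBall.IsSparse k (X 1) →
        HeavyBall.IsHBROT A y k ω α β X → ∀ p : ℕ, 1 ≤ p →
        ‖X p - HeavyBall.restrict x S‖ ≤
          HeavyBall.theta1 A k ω α β ^ (p - 1) *
            (‖X 1 - HeavyBall.restrict x S‖ +
              (HeavyBall.theta1 A k ω α β - HeavyBall.b1 A k ω α β) *
                ‖X 0 - HeavyBall.restrict x S‖) +
          HeavyBall.b3 A k ω α β / (1 - HeavyBall.theta1 A k ω α β) *
            ‖ν + HeavyBall.app A (HeavyBall.restrict x Sᶜ)‖) ∧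
    (∀ γ : ℝ, HeavyBall.IsGammaSharp ω γ → HeavyBall.ric A (3 * k) < γ →
      HeavyBall.RangeHBROTP A k ω α β →
      HeavyBall.theta2 A k ω α β < 1 ∧
      ∀ X : ℕ → HeavyBall.Vec n, HeavyBall.IsSparse k (X 1) →
        HeavyBall.IsHBROTP A y k ω α β X → ∀ p : ℕ, 1 ≤ p →
        ‖X p - HeavyBall.restrict x S‖ ≤
          HeavyBall.theta2 A k ω α β ^ (p - 1) *
            (‖X 1 - HeavyBall.restrict x S‖ +
              (HeavyBall.theta2 A k ω α β - HeavyBall.b1 A k ω α β / HeavyBall.z A k) *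
                ‖X 0 - HeavyBall.restrict x S‖) +
          1 / (1 - HeavyBall.theta2 A k ω α β) *
            (HeavyBall.b3 A k ω α β / HeavyBall.z A k +
              √(1 + HeavyBall.ric A k) / (1 - HeavyBall.ric A (2 * k))) *
            ‖ν + HeavyBall.app A (HeavyBall.restrict x Sᶜ)‖) := by
  have hs := HeavyBall.supp_restrict_subset x S
  have hy' : y = HeavyBall.app A (HeavyBall.restrict x S) +
      (ν + HeavyBall.app A (HeavyBall.restrict x Sᶜ)) := by
    conv_lhs => rw [hy, ← HeavyBall.restrict_add_restrict_compl x S, HeavyBall.app_add]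
    abel
  -- Either threshold enters the error bounds only through `δ_{2k} ≤ δ_{3k} < 1`; the contraction
  -- comes from the parameter range.
  have h2k : ∀ γ : ℝ, γ < 1 → HeavyBall.ric A (3 * k) < γ → HeavyBall.ric A (2 * k) < 1 :=
    fun γ h1 h2 => (HeavyBall.ric_mono A (by omega)).trans_lt (h2.trans h1)
  subst hy'
  refine ⟨HeavyBall.existsUnique_isGammaStar hω, HeavyBall.existsUnique_isGammaSharp hω,
    fun γ hγ hlt hR => ?_, fun γ hγ hlt hR => ?_⟩
  · obtain ⟨h1, h2⟩ := hbrot_error_bound hk hω hmn hn A hs hS.1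
      (ν + HeavyBall.app A (HeavyBall.restrict x Sᶜ)) (h2k γ hγ.1.2 hlt) hR
    refine ⟨h1, fun X hX1 hX p hp => ?_⟩
    have := h2 X hX1 hX (p - 1)
    rwa [Nat.sub_add_cancel hp] at this
  · obtain ⟨h1, h2⟩ := hbrotp_error_bound hk hω hmn hn A hs hS.1
      (ν + HeavyBall.app A (HeavyBall.restrict x Sᶜ)) (h2k γ hγ.1.2 hlt) hR
    refine ⟨h1, fun X hX1 hX p hp => ?_⟩
    have := h2 X hX1 hX (p - 1)
    rwa [Nat.sub_add_cancel hp] at this
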